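/- \textbf{Setting.} Let $\Bbbk$ be a field. A \emph{conic quantum space} $\mathcal A=(\mathbf A_1,\mathbf A)$ is a finite-dimensional vector space $\mathbf A_1$ together with a graded algebra $\mathbf A=\bigoplus_n\mathbf A_n=\mathbf A_1^{\otimes}/\mathbf I$, where $\mathbf A_1^\otimes$ is the tensor algebra and $\mathbf I=\bigoplus_{n\ge 2}\mathbf I_n$ a graded two-sided ideal. Morphisms are the algebra morphisms mapping generators to generators; $\mathrm{CA}$ is the resulting category, $\mathfrak H:\mathrm{CA}\to\mathrm{GrVct}$ the forgetful functor to graded vector spaces, $\mathcal A\circ\mathcal B=(\mathbf A_1\otimes\mathbf B_1,\bigoplus_n\mathbf A_n\otimes\mathbf B_n)$, and $\mathcal K=(\Bbbk,\Bbbk[e])$. If $\mathbf J$ is the ideal of $\mathcal B$, $\mathcal B\triangleright\mathcal A$ is generated by $\mathbf B_1^*\otimes\mathbf A_1$ with ideal generated by $\bigoplus_n\mathbf J_n^\perp\otimes\mathbf I_n$ (inside $(\mathbf B_1^*)^{\otimes n}\otimes\mathbf A_1^{\otimes n}\simeq(\mathbf B_1^*\otimes\mathbf A_1)^{\otimes n}$).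 \textbf{Cochains.} $\mathfrak Z^2[V]$ is the set of families $\psi=(\psi_{r,s})$ of linear automorphisms of $V^{\otimes r}\otimes V^{\otimes s}$ with $\psi_{0,s}=\mathrm{id}$, $\psi_{r,0}=\mathrm{id}$ and $\psi_{r+s,t}(\psi_{r,s}\otimes\mathrm{id})=\psi_{r,s+t}(\mathrm{id}\otimes\psi_{s,t})$ (counital 2-cocycles). Each such $\psi$ is $\partial\theta$ for a unique family $\theta_n\in\mathrm{Aut}(V^{\otimes n})$ with $\theta_0=\mathrm{id}$, $\theta_1=\mathrm{id}$, where $(\partial\theta)_{r,s}=\theta_{r+s}(\theta_r\otimes\theta_s)^{-1}$; put $\mathfrak i\psi=\partial(\theta^{-1})$. For finite-dimensional $V$, $\psi^!\in\mathfrak Z^2[V^*]$ is the contragredient of $\psi$, and $\mathfrak j(\psi_1,\dots,\psi_m)\in\mathfrak Z^2[V_1\otimes\dots\otimes V_m]$ is $\psi_1\otimes\dots\otimes\psi_m$ transported by the shuffle isomorphisms. A cochain $\psi\in\mathfrak Z^2[\mathbf A_1]$ is \emph{$\mathcal A$-admissible} if every $\psi_{r,s}$ preserves $\mathbf I_r\otimes\mathbf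 A_1^{\otimes s}+\mathbf A_1^{\otimes r}\otimes\mathbf I_s$, and \emph{2nd $\mathcal A$-admissible} if moreover, for all $i,m,j,s$, $\psi_{i+m+j,s}$ preserves $(\mathbf A_1^{\otimes i}\otimes\mathbf I_m\otimes\mathbf A_1^{\otimes j})\otimes\mathbf A_1^{\otimes s}$ and $\psi_{s,i+m+j}$ preserves $\mathbf A_1^{\otimes s}\otimes(\mathbf A_1^{\otimes i}\otimes\mathbf I_m\otimes\mathbf A_1^{\otimes j})$. For admissible $\psi$, $\mathcal A_\psi$ denotes $\mathcal A$ with the same graded space and the product $m\circ\psi$; it is again a conic quantum space generated by $\mathbf A_1$. \textbf{The categories $\Omega^{\mathcal A,\mathcal B}$.} Let $\omega_{\mathcal A,\mathcal B}\in\mathfrak Z^2[\mathbf B_1^*\otimes\mathbf A_1\otimes\mathbf B_1]$ be given for all $\mathcal A,\mathcal B\in\mathrm{CA}$. For an object $\langle\varphi,\mathcal H\rangle$, $\varphi:\mathfrak H(\mathcal A)\to\mathfrak H(\mathcal H\circ\mathcal B)$, of the comma category $(\mathfrak H(\mathcal A)\downarrow\mathfrak H(\mathrm{CA}\circ\mathcal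 B))$ write $\varphi(a)=\sum_j h^j(a)\otimes b_j$ for $a\in\mathbf A_1$, with $(b_j)$ a basis of $\mathbf B_1$ and $(b^j)$ its dual basis; let $\mathbf H_1^\varphi\subseteq\mathbf H_1$ be the image of $\pi^\varphi:\mathbf B_1^*\otimes\mathbf A_1\to\mathbf H_1$, $b^j\otimes a\mapsto h^j(a)$, and $\mathcal H^\varphi$ the subalgebra of $\mathcal H$ generated by $\mathbf H_1^\varphi$. Then $\Omega^{\mathcal A,\mathcal B}$ is the full subcategory of those $\langle\varphi,\mathcal H\rangle$ for which $\omega_{\mathcal A,\mathcal B}$ descends along $\pi^\varphi\otimes\mathrm{id}$ to an element $\bar\omega$ of $\mathfrak Z^2[\mathbf H_1^\varphi\otimes\mathbf B_1]$ that is $\mathcal H^\varphi\circ\mathcal B$-admissible, and $\varphi$ takes values in $\mathcal H^\varphi\circ\mathcal B$ and is an algebra morphism $\mathcal A\to(\mathcal H^\varphi\circ\mathcal B)_{\bar\omega}$. \textbf{Theorem.} Suppose the collection $\{\omega_{\mathcal A,\mathcal B}\}$ is factorizable, given by $\psi_{\mathcal A}\in\mathfrak Z^2[\mathbf A_1]$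 ($\mathcal A\in\mathrm{CA}$), i.e. $\omega_{\mathcal A,\mathcal B}=\mathfrak j(\psi_{\mathcal B}^!,\psi_{\mathcal A},\mathbb I^{\otimes 2})$ for all $\mathcal A,\mathcal B$, and suppose that each $\mathfrak i\psi_{\mathcal A}$ is 2nd $\mathcal A$-admissible. Then, for all $\mathcal A,\mathcal B\in\mathrm{CA}$, the category $\Omega^{\mathcal A,\mathcal B}$ has an initial object, whose underlying quantum space is $$\underline{hom}^\Omega[\mathcal B,\mathcal A]=\mathcal B_{\mathfrak i\psi_{\mathcal B}}\triangleright\mathcal A_{\mathfrak i\psi_{\mathcal A}}=(\mathcal B\triangleright\mathcal A)_{\mathfrak j((\mathfrak i\psi_{\mathcal B})^!,\,\mathfrak i\psi_{\mathcal A})},$$ the cochain $\mathfrak j((\mathfrak i\psi_{\mathcal B})^!,\mathfrak i\psi_{\mathcal A})$ being $\mathcal B\triangleright\mathcal A$-admissible. In particular, up to isomorphism in $\mathrm{CA}$, $\underline{hom}^\Omega[\mathcal K,\mathcal A]=\mathcal A_{\mathfrak i\psi_{\mathcal A}}$ and $\underline{hom}^\Omega[\mathcal K,\mathcal K]=\mathcal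 K$, and hence $$\underline{hom}^\Omega[\mathcal B,\mathcal A]=\underline{hom}^\Omega[\mathcal K,\mathcal B]\triangleright\underline{hom}^\Omega[\mathcal K,\mathcal A].$$ -/

import Mathlib

open scoped TensorProduct
open CategoryTheory

universe u

noncomputable section

namespace QSpace

/-! ### Multiplication and shuffles of tensor powers -/

section Tensor

variable {k : Type u} [Field k] {V W U : Type u} [AddCommGroup V] [Module k V]
  [AddCommGroup W] [Module k W] [AddCommGroup U] [Module k U]

/-- Concatenation `V^{⊗r} ⊗ V^{⊗s} ≃ V^{⊗(r+s)}`, the product of the tensor algebra `V^⊗`. -/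
abbrev mu (r s : ℕ) : (⨂[k]^r V) ⊗[k] (⨂[k]^s V) ≃ₗ[k] ⨂[k]^(r + s) V :=
  TensorPower.mulEquiv

theorem mu_tprod (r s : ℕ) (a : Fin r → V) (b : Fin s → V) :
    mu (k := k) r s (PiTensorProduct.tprod k a ⊗ₜ PiTensorProduct.tprod k b) =
      PiTensorProduct.tprod k (Fin.append a b) :=
  TensorPower.tprod_mul_tprod k a b

/-- The unit of the tensor algebra, in degree `0`. -/
def tone (k V : Type u) [Field k] [AddCommGroup V] [Module k V] : ⨂[k]^0 V :=
  PiTensorProduct.tprod k Fin.elim0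

theorem mu_assoc (r s t : ℕ) (x : ⨂[k]^r V) (y : ⨂[k]^s V) (z : ⨂[k]^t V) :
    TensorPower.cast k V (add_assoc r s t) (mu (r + s) t (mu r s (x ⊗ₜ y) ⊗ₜ z)) =
      mu r (s + t) (x ⊗ₜ mu s t (y ⊗ₜ z)) :=
  TensorPower.mul_assoc x y z

theorem tensor_ext {n : ℕ} {M : Type*} [AddCommGroup M] [Module k M]
    {f g : (⨂[k]^n V) →ₗ[k] M}
    (h : ∀ a : Fin n → V, f (PiTensorProduct.tprod k a) = g (PiTensorProduct.tprod k a)) :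
    f = g :=
  PiTensorProduct.ext (MultilinearMap.ext h)

theorem tensor_ext₂ {r s : ℕ} {M : Type*} [AddCommGroup M] [Module k M]
    {f g : ((⨂[k]^r V) ⊗[k] (⨂[k]^s W)) →ₗ[k] M}
    (h : ∀ (a : Fin r → V) (b : Fin s → W),
      f (PiTensorProduct.tprod k a ⊗ₜ PiTensorProduct.tprod k b) =
      g (PiTensorProduct.tprod k a ⊗ₜ PiTensorProduct.tprod k b)) :
    f = g := by
  apply TensorProduct.ext
  apply tensor_ext
  intro a
  apply tensor_ext
  intro b
  exact h a b

/-- The functorial action of a linear map on tensor powers. -/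
def pw (f : V →ₗ[k] W) (n : ℕ) : (⨂[k]^n V) →ₗ[k] ⨂[k]^n W :=
  PiTensorProduct.map (fun _ => f)

@[simp] theorem pw_tprod (f : V →ₗ[k] W) (n : ℕ) (a : Fin n → V) :
    pw f n (PiTensorProduct.tprod k a) = PiTensorProduct.tprod k (fun i => f (a i)) :=
  PiTensorProduct.map_tprod _ _

theorem pw_id (n : ℕ) : pw (LinearMap.id : V →ₗ[k] V) n = LinearMap.id :=
  PiTensorProduct.map_id

theorem pw_comp (g : W →ₗ[k] U) (f : V →ₗ[k] W) (n : ℕ) :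
    pw (g ∘ₗ f) n = pw g n ∘ₗ pw f n :=
  PiTensorProduct.map_comp _ _

theorem pw_mu (f : V →ₗ[k] W) (r s : ℕ) (x : ⨂[k]^r V) (y : ⨂[k]^s V) :
    pw f (r + s) (mu r s (x ⊗ₜ y)) = mu r s (pw f r x ⊗ₜ pw f s y) := by
  have : (pw f (r + s)) ∘ₗ (mu (k := k) (V := V) r s).toLinearMap =
      (mu r s).toLinearMap ∘ₗ TensorProduct.map (pw f r) (pw f s) := by
    apply tensor_ext₂
    intro a b
    simp only [LinearMap.comp_apply, LinearEquiv.coe_coe, TensorProduct.map_tmul, mu_tprod,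
      pw_tprod]
    congr 1
    funext i
    refine Fin.addCases (fun i => ?_) (fun i => ?_) i <;> simp
  exact LinearMap.congr_fun this (x ⊗ₜ y)

/-- `V^{⊗0} ≃ k`. -/
def pwZero : (⨂[k]^0 V) ≃ₗ[k] k :=
  PiTensorProduct.isEmptyEquiv (Fin 0)

/-- `V^{⊗1} ≃ V`. -/
def pwOne : (⨂[k]^1 V) ≃ₗ[k] V :=
  PiTensorProduct.subsingletonEquiv (0 : Fin 1)

theorem pwZero_tprod (a : Fin 0 → V) : pwZero (PiTensorProduct.tprod k a) = 1 :=
  PiTensorProduct.isEmptyEquiv_apply_tprod _ _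

theorem pwOne_tprod (a : Fin 1 → V) : pwOne (PiTensorProduct.tprod k a) = a 0 :=
  PiTensorProduct.subsingletonEquiv_apply_tprod _ _

theorem pwOne_symm (v : V) : pwOne.symm v = PiTensorProduct.tprod k (fun _ : Fin 1 => v) := by
  rw [LinearEquiv.symm_apply_eq, pwOne_tprod]

/-- The shuffle `(W ⊗ V)^{⊗n} ≃ W^{⊗n} ⊗ V^{⊗n}`, built by recursion on `n`; see
`shuffle_tprod` for its values. -/
def shuffle : (n : ℕ) → (⨂[k]^n (W ⊗[k] V)) ≃ₗ[k] (⨂[k]^n W) ⊗[k] (⨂[k]^n V)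
  | 0 => pwZero ≪≫ₗ (TensorProduct.lid k k).symm ≪≫ₗ
      TensorProduct.congr pwZero.symm pwZero.symm
  | n + 1 => (mu n 1).symm ≪≫ₗ
      TensorProduct.congr (shuffle n)
        (pwOne ≪≫ₗ TensorProduct.congr pwOne.symm pwOne.symm) ≪≫ₗ
      TensorProduct.tensorTensorTensorComm k _ _ _ _ ≪≫ₗ
      TensorProduct.congr (mu n 1) (mu n 1)

/-- `(w₁ ⊗ v₁) ⋯ (wₙ ⊗ vₙ) ↦ w₁ ⋯ wₙ ⊗ v₁ ⋯ vₙ`. -/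
theorem shuffle_tprod (n : ℕ) (w : Fin n → W) (v : Fin n → V) :
    shuffle n (PiTensorProduct.tprod k (fun i => w i ⊗ₜ[k] v i)) =
      PiTensorProduct.tprod k w ⊗ₜ PiTensorProduct.tprod k v := by
  induction n with
  | zero =>
    have hw : pwZero.symm 1 = PiTensorProduct.tprod k w := by
      rw [LinearEquiv.symm_apply_eq, pwZero_tprod]
    have hv : pwZero.symm 1 = PiTensorProduct.tprod k v := by
      rw [LinearEquiv.symm_apply_eq, pwZero_tprod]
    simp only [shuffle, LinearEquiv.trans_apply, pwZero_tprod,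
      TensorProduct.lid_symm_apply, TensorProduct.congr_tmul, hw, hv]
  | succ n ih =>
    have key : ∀ {X : Type u} [AddCommGroup X] [Module k X] (x : Fin (n + 1) → X),
        PiTensorProduct.tprod k x = mu (k := k) n 1
          (PiTensorProduct.tprod k (fun i => x (Fin.castSucc i)) ⊗ₜ
            PiTensorProduct.tprod k (fun _ : Fin 1 => x (Fin.last n))) := by
      intro X _ _ x
      rw [mu_tprod]
      congr 1
      funext i
      refine Fin.lastCases ?_ (fun i => ?_) i
      · exact (Fin.append_right (fun i => x (Fin.castSucc i))
          (fun _ : Fin 1 => x (Fin.last n)) (0 : Fin 1)).symm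
      · exact (Fin.append_left (fun i => x (Fin.castSucc i))
          (fun _ : Fin 1 => x (Fin.last n)) i).symm
    rw [key, key w, key v]
    simp only [shuffle, LinearEquiv.trans_apply, LinearEquiv.symm_apply_apply,
      TensorProduct.congr_tmul, ih, pwOne_tprod, pwOne_symm,
      TensorProduct.tensorTensorTensorComm_tmul]

theorem shuffle_ext {n : ℕ} {M : Type*} [AddCommGroup M] [Module k M]
    {f g : (⨂[k]^n (W ⊗[k] V)) →ₗ[k] M}
    (h : ∀ (w : Fin n → W) (v : Fin n → V),
      f (PiTensorProduct.tprod k (fun i => w i ⊗ₜ[k] v i)) =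
      g (PiTensorProduct.tprod k (fun i => w i ⊗ₜ[k] v i))) :
    f = g := by
  have : f ∘ₗ (shuffle (k := k) (W := W) (V := V) n).symm.toLinearMap =
      g ∘ₗ (shuffle (k := k) (W := W) (V := V) n).symm.toLinearMap := by
    apply tensor_ext₂
    intro w v
    simp only [LinearMap.comp_apply, LinearEquiv.coe_coe, ← shuffle_tprod,
      LinearEquiv.symm_apply_apply, h]
  ext1
  ext x
  simpa using LinearMap.congr_fun this (shuffle n (PiTensorProduct.tprod k x))

/-- The shuffle `(W ⊗ V)^{⊗r} ⊗ (W ⊗ V)^{⊗s} ≃ (W^{⊗r} ⊗ W^{⊗s}) ⊗ (V^{⊗r} ⊗ V^{⊗s})`. -/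
def shuffle₂ (r s : ℕ) :
    (⨂[k]^r (W ⊗[k] V)) ⊗[k] (⨂[k]^s (W ⊗[k] V)) ≃ₗ[k]
      ((⨂[k]^r W) ⊗[k] (⨂[k]^s W)) ⊗[k] ((⨂[k]^r V) ⊗[k] (⨂[k]^s V)) :=
  TensorProduct.congr (shuffle r) (shuffle s) ≪≫ₗ
    TensorProduct.tensorTensorTensorComm k _ _ _ _

theorem shuffle_mu (r s : ℕ) (u : (⨂[k]^r (W ⊗[k] V)) ⊗[k] (⨂[k]^s (W ⊗[k] V))) :
    shuffle (r + s) (mu r s u) =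
      TensorProduct.map (mu r s).toLinearMap (mu r s).toLinearMap (shuffle₂ r s u) := by
  have : (shuffle (k := k) (W := W) (V := V) (r + s)).toLinearMap ∘ₗ (mu r s).toLinearMap =
      TensorProduct.map (mu r s).toLinearMap (mu r s).toLinearMap ∘ₗ
        (shuffle₂ r s).toLinearMap := by
    apply TensorProduct.ext
    refine shuffle_ext (M := (⨂[k]^s (W ⊗[k] V)) →ₗ[k]
      (⨂[k]^(r + s) W) ⊗[k] (⨂[k]^(r + s) V)) ?_
    intro w v
    apply shuffle_ext
    intro w' v'
    have happ : Fin.append (fun i => w i ⊗ₜ[k] v i) (fun i => w' i ⊗ₜ[k] v' i) =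
        fun i => Fin.append w w' i ⊗ₜ[k] Fin.append v v' i := by
      funext i
      refine Fin.addCases (fun i => ?_) (fun i => ?_) i <;> simp
    change shuffle (r + s) (mu r s (_ ⊗ₜ _)) =
      TensorProduct.map (mu r s).toLinearMap (mu r s).toLinearMap (shuffle₂ r s (_ ⊗ₜ _))
    simp only [shuffle₂, LinearEquiv.trans_apply, TensorProduct.congr_tmul, shuffle_tprod,
      TensorProduct.tensorTensorTensorComm_tmul, TensorProduct.map_tmul, LinearEquiv.coe_coe,
      mu_tprod, happ]
  exact LinearMap.congr_fun this u

theorem shuffle_pw {W' V' : Type u} [AddCommGroup V'] [Module k V']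
    [AddCommGroup W'] [Module k W'] (f : W →ₗ[k] W') (g : V →ₗ[k] V') (n : ℕ)
    (x : ⨂[k]^n (W ⊗[k] V)) :
    shuffle n (pw (TensorProduct.map f g) n x) =
      TensorProduct.map (pw f n) (pw g n) (shuffle n x) := by
  have : (shuffle n).toLinearMap ∘ₗ pw (TensorProduct.map f g) n =
      TensorProduct.map (pw f n) (pw g n) ∘ₗ (shuffle n).toLinearMap := by
    apply shuffle_ext
    intro w v
    simp only [LinearMap.comp_apply, LinearEquiv.coe_coe, TensorProduct.map_tmul, shuffle_tprod,
      pw_tprod]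
  exact LinearMap.congr_fun this x

/-- The natural (order preserving) identification `(V^*)^{⊗n} ≃ (V^{⊗n})^*`. -/
abbrev dualPw [FiniteDimensional k V] (n : ℕ) :
    (⨂[k]^n (Module.Dual k V)) ≃ₗ[k] Module.Dual k (⨂[k]^n V) :=
  PiTensorProduct.dualDistribEquiv

/-- The natural identification `(V^*)^{⊗r} ⊗ (V^*)^{⊗s} ≃ (V^{⊗r} ⊗ V^{⊗s})^*`. -/
def dualPw₂ [FiniteDimensional k V] (r s : ℕ) :
    (⨂[k]^r (Module.Dual k V)) ⊗[k] (⨂[k]^s (Module.Dual k V)) ≃ₗ[k]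
      Module.Dual k ((⨂[k]^r V) ⊗[k] (⨂[k]^s V)) :=
  TensorProduct.congr (dualPw r) (dualPw s) ≪≫ₗ TensorProduct.dualDistribEquiv k _ _

theorem dualPw_tprod [FiniteDimensional k V] {n : ℕ} (f : Fin n → Module.Dual k V)
    (a : Fin n → V) :
    dualPw n (PiTensorProduct.tprod k f) (PiTensorProduct.tprod k a) = ∏ i, f i (a i) :=
  PiTensorProduct.dualDistrib_apply f a

theorem dualPw₂_tmul [FiniteDimensional k V] {r s : ℕ} (f : ⨂[k]^r (Module.Dual k V))
    (g : ⨂[k]^s (Module.Dual k V)) (x : ⨂[k]^r V) (y : ⨂[k]^s V) :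
    dualPw₂ r s (f ⊗ₜ g) (x ⊗ₜ y) = dualPw r f x * dualPw s g y := by
  simp [dualPw₂]

theorem dualPw_mu [FiniteDimensional k V] (r s : ℕ)
    (u : (⨂[k]^r (Module.Dual k V)) ⊗[k] (⨂[k]^s (Module.Dual k V)))
    (x : (⨂[k]^r V) ⊗[k] (⨂[k]^s V)) :
    dualPw (r + s) (mu r s u) (mu r s x) = dualPw₂ r s u x := by
  have : (mu (k := k) (V := V) r s).dualMap.toLinearMap ∘ₗ (dualPw (r + s)).toLinearMap ∘ₗ
      (mu r s).toLinearMap = (dualPw₂ (k := k) (V := V) r s).toLinearMap := by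
    apply tensor_ext₂
    intro f g
    apply tensor_ext₂
    intro a b
    simp only [LinearMap.comp_apply, LinearEquiv.coe_coe, mu_tprod, LinearEquiv.dualMap_apply,
      dualPw₂_tmul, dualPw_tprod, Fin.prod_univ_add, Fin.append_left, Fin.append_right]
  exact LinearMap.congr_fun (LinearMap.congr_fun this u) x

end Tensor

/-! ### The cochains `C^•[V]` in degrees one and two -/

section Cochains

/-- `C^1[V]`: homogeneous linear automorphisms of `V^⊗`. -/
abbrev Cochain1 (k V : Type u) [Field k] [AddCommGroup V] [Module k V] : Type u :=
  ∀ n : ℕ, (⨂[k]^n V) ≃ₗ[k] ⨂[k]^n V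

/-- `C^2[V]`: (bi)homogeneous linear automorphisms of `V^⊗ ⊗ V^⊗`. -/
abbrev Cochain2 (k V : Type u) [Field k] [AddCommGroup V] [Module k V] : Type u :=
  ∀ r s : ℕ, ((⨂[k]^r V) ⊗[k] ⨂[k]^s V) ≃ₗ[k] (⨂[k]^r V) ⊗[k] ⨂[k]^s V

/-- Counital 2-cocycles. Identifying `V^{⊗r} ⊗ V^{⊗s} ⊗ V^{⊗t}` with `V^{⊗(r+s+t)}`, the cocycle
condition is `ψ_{r+s,t} (ψ_{r,s} ⊗ id) = ψ_{r,s+t} (id ⊗ ψ_{s,t})`; the cochain is counital when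
`ψ_{0,s}` and `ψ_{r,0}` are identities. -/
@[ext] structure Z2 (k V : Type u) [Field k] [AddCommGroup V] [Module k V] where
  toFun : Cochain2 k V
  counit_left : ∀ s, toFun 0 s = LinearEquiv.refl k _
  counit_right : ∀ r, toFun r 0 = LinearEquiv.refl k _
  cocycle : ∀ (r s t : ℕ) (x : ⨂[k]^r V) (y : ⨂[k]^s V) (z : ⨂[k]^t V),
    TensorPower.cast k V (add_assoc r s t)
        (mu (r + s) t (toFun (r + s) t (mu r s (toFun r s (x ⊗ₜ y)) ⊗ₜ z))) =
      mu r (s + t) (toFun r (s + t) (x ⊗ₜ mu s t (toFun s t (y ⊗ₜ z))))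

variable {k : Type u} [Field k] {V W : Type u} [AddCommGroup V] [Module k V]
  [AddCommGroup W] [Module k W]

/-- The coboundary `(∂θ)_{r,s} = θ_{r+s} (θ_r ⊗ θ_s)⁻¹`. -/
def coboundary (θ : Cochain1 k V) : Cochain2 k V := fun r s =>
  (TensorProduct.congr (θ r) (θ s)).symm ≪≫ₗ mu r s ≪≫ₗ θ (r + s) ≪≫ₗ (mu r s).symm

theorem mu_coboundary (θ : Cochain1 k V) (r s : ℕ) (u : (⨂[k]^r V) ⊗[k] ⨂[k]^s V) :
    mu r s (coboundary θ r s u) =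
      θ (r + s) (mu r s ((TensorProduct.congr (θ r) (θ s)).symm u)) := by
  simp [coboundary]

theorem Cochain1.cast_comm (θ : Cochain1 k V) {i j : ℕ} (h : i = j) (x : ⨂[k]^i V) :
    θ j (TensorPower.cast k V h x) = TensorPower.cast k V h (θ i x) := by
  subst h
  simp

theorem exists_smul_tone (x : ⨂[k]^0 V) : ∃ c : k, x = c • tone k V := by
  refine ⟨pwZero x, ?_⟩
  apply (pwZero (k := k) (V := V)).injective
  rw [map_smul, tone, pwZero_tprod, smul_eq_mul, mul_one]

theorem tone_mu (s : ℕ) (y : ⨂[k]^s V) :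
    mu 0 s (tone k V ⊗ₜ y) = TensorPower.cast k V (zero_add s).symm y := by
  have := TensorPower.one_mul (R := k) y
  rw [← TensorPower.cast_symm, LinearEquiv.eq_symm_apply]
  exact this

theorem mu_tone (r : ℕ) (x : ⨂[k]^r V) :
    mu r 0 (x ⊗ₜ tone k V) = TensorPower.cast k V (add_zero r).symm x := by
  have := TensorPower.mul_one (R := k) x
  rw [← TensorPower.cast_symm, LinearEquiv.eq_symm_apply]
  exact this

/-- The coboundary of a 1-cochain that is trivial in degree `0` is a counital 2-cocycle. -/
def Z2.ofCochain1 (θ : Cochain1 k V) (h : θ 0 = LinearEquiv.refl k _) : Z2 k V where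
  toFun := coboundary θ
  counit_left s := by
    apply LinearEquiv.toLinearMap_injective
    apply TensorProduct.ext'
    intro x y
    apply (mu (k := k) (V := V) 0 s).injective
    obtain ⟨c, rfl⟩ := exists_smul_tone x
    simp only [LinearEquiv.coe_coe, mu_coboundary, TensorProduct.congr_symm_tmul, h,
      LinearEquiv.refl_symm, LinearEquiv.refl_apply, ← TensorProduct.smul_tmul', map_smul,
      tone_mu, Cochain1.cast_comm, LinearEquiv.apply_symm_apply]
  counit_right r := by
    apply LinearEquiv.toLinearMap_injective
    apply TensorProduct.ext'
    intro x y
    apply (mu (k := k) (V := V) r 0).injective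
    obtain ⟨c, rfl⟩ := exists_smul_tone y
    simp only [LinearEquiv.coe_coe, mu_coboundary, TensorProduct.congr_symm_tmul, h,
      LinearEquiv.refl_symm, LinearEquiv.refl_apply, TensorProduct.tmul_smul, map_smul,
      mu_tone, Cochain1.cast_comm, LinearEquiv.apply_symm_apply]
  cocycle r s t x y z := by
    simp only [mu_coboundary, TensorProduct.congr_symm_tmul, LinearEquiv.symm_apply_apply,
      ← Cochain1.cast_comm, mu_assoc]

/-- The primitive `θ` of a 2-cocycle `ψ`: the iterated twisted product of generators,
`θ_0 = id` and `θ_{n+1}(x ⊗ v) = ψ_{n,1}(θ_n(x) ⊗ v)`; it is the identity on `V` and satisfies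
`ψ = ∂θ`, see `coboundary_prim`. -/
def prim (ψ : Cochain2 k V) : Cochain1 k V
  | 0 => LinearEquiv.refl k _
  | n + 1 => (mu n 1).symm ≪≫ₗ
      TensorProduct.congr (prim ψ n) (LinearEquiv.refl k _) ≪≫ₗ ψ n 1 ≪≫ₗ mu n 1

theorem prim_succ (ψ : Cochain2 k V) (n : ℕ) (x : ⨂[k]^n V) (v : ⨂[k]^1 V) :
    prim ψ (n + 1) (mu n 1 (x ⊗ₜ v)) = mu n 1 (ψ n 1 (prim ψ n x ⊗ₜ v)) := by
  simp only [prim, LinearEquiv.trans_apply, LinearEquiv.symm_apply_apply,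
    TensorProduct.congr_tmul, LinearEquiv.refl_apply]

theorem prim_one (ψ : Z2 k V) (v : ⨂[k]^1 V) : prim ψ.toFun 1 v = v := by
  obtain ⟨v, rfl⟩ := (TensorPower.cast k V (zero_add 1)).surjective v
  rw [Cochain1.cast_comm]
  congr 1
  obtain ⟨u, rfl⟩ := (mu (k := k) (V := V) 0 1).surjective v
  change mu 0 1 (ψ.toFun 0 1 (TensorProduct.congr (prim ψ.toFun 0) (LinearEquiv.refl k _)
    ((mu 0 1).symm (mu 0 1 u)))) = _
  rw [ψ.counit_left, LinearEquiv.symm_apply_apply, LinearEquiv.refl_apply]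
  congr 1
  exact LinearEquiv.congr_fun TensorProduct.congr_refl_refl u

theorem prim_mu (ψ : Z2 k V) (r s : ℕ) (x : ⨂[k]^r V) (y : ⨂[k]^s V) :
    mu r s (ψ.toFun r s (prim ψ.toFun r x ⊗ₜ prim ψ.toFun s y)) =
      prim ψ.toFun (r + s) (mu r s (x ⊗ₜ y)) := by
  induction s with
  | zero =>
    obtain ⟨c, rfl⟩ := exists_smul_tone y
    have h0 : ∀ y, prim ψ.toFun 0 y = y := fun _ => rfl
    simp only [h0, ψ.counit_right, LinearEquiv.refl_apply, TensorProduct.tmul_smul, map_smul,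
      mu_tone, Cochain1.cast_comm]
  | succ s ih =>
    obtain ⟨u, rfl⟩ := (mu (k := k) (V := V) s 1).surjective y
    induction u using TensorProduct.induction_on with
    | zero => simp
    | add u v hu hv => simp only [map_add, TensorProduct.tmul_add, hu, hv]
    | tmul y v =>
      rw [prim_succ, ← ψ.cocycle, ih, ← mu_assoc, Cochain1.cast_comm, prim_succ]

theorem coboundary_prim (ψ : Z2 k V) : coboundary (prim ψ.toFun) = ψ.toFun := by
  funext r s
  apply LinearEquiv.toLinearMap_injective
  apply TensorProduct.ext'
  intro x y
  apply (mu (k := k) (V := V) r s).injective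
  simp only [LinearEquiv.coe_coe, mu_coboundary, TensorProduct.congr_symm_tmul, ← prim_mu,
    LinearEquiv.apply_symm_apply]

/-- `𝔦ψ = ∂(θ⁻¹)` for `ψ = ∂θ` with `θ` primitive. -/
def Z2.inv (ψ : Z2 k V) : Z2 k V :=
  Z2.ofCochain1 (fun n => (prim ψ.toFun n).symm) rfl

/-- The identity cochain `𝕀^{⊗2}`. -/
def Z2.one (k V : Type u) [Field k] [AddCommGroup V] [Module k V] : Z2 k V where
  toFun _ _ := LinearEquiv.refl k _
  counit_left _ := rfl
  counit_right _ := rfl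
  cocycle r s t x y z := mu_assoc r s t x y z

/-- The contragredient of a 1-cochain, on `V^*`. -/
def Cochain1.dual [FiniteDimensional k V] (θ : Cochain1 k V) :
    Cochain1 k (Module.Dual k V) := fun n =>
  dualPw n ≪≫ₗ (θ n).symm.dualMap ≪≫ₗ (dualPw n).symm

/-- The contragredient of a 2-cochain, on `V^*`: `⟨ψ^! f, x⟩ = ⟨f, ψ⁻¹ x⟩`. -/
def Cochain2.dual [FiniteDimensional k V] (ψ : Cochain2 k V) :
    Cochain2 k (Module.Dual k V) := fun r s =>
  dualPw₂ r s ≪≫ₗ (ψ r s).symm.dualMap ≪≫ₗ (dualPw₂ r s).symm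

theorem dualPw_dual [FiniteDimensional k V] (θ : Cochain1 k V) (n : ℕ)
    (f : ⨂[k]^n (Module.Dual k V)) (x : ⨂[k]^n V) :
    dualPw n (θ.dual n f) x = dualPw n f ((θ n).symm x) := by
  simp only [Cochain1.dual, LinearEquiv.trans_apply, LinearEquiv.apply_symm_apply,
    LinearEquiv.dualMap_apply]

theorem dualPw₂_dual [FiniteDimensional k V] (ψ : Cochain2 k V) (r s : ℕ)
    (f : (⨂[k]^r (Module.Dual k V)) ⊗[k] ⨂[k]^s (Module.Dual k V))
    (x : (⨂[k]^r V) ⊗[k] ⨂[k]^s V) :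
    dualPw₂ r s (ψ.dual r s f) x = dualPw₂ r s f ((ψ r s).symm x) := by
  simp only [Cochain2.dual, LinearEquiv.trans_apply, LinearEquiv.apply_symm_apply,
    LinearEquiv.dualMap_apply]

theorem dualPw_dual_symm [FiniteDimensional k V] (θ : Cochain1 k V) (n : ℕ)
    (f : ⨂[k]^n (Module.Dual k V)) (x : ⨂[k]^n V) :
    dualPw n ((θ.dual n).symm f) x = dualPw n f (θ n x) := by
  have := dualPw_dual θ n ((θ.dual n).symm f) (θ n x)
  rw [LinearEquiv.apply_symm_apply, LinearEquiv.symm_apply_apply] at this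
  exact this.symm

theorem dualPw₂_congr_dual [FiniteDimensional k V] (θ : Cochain1 k V) (r s : ℕ)
    (f : (⨂[k]^r (Module.Dual k V)) ⊗[k] ⨂[k]^s (Module.Dual k V))
    (x : (⨂[k]^r V) ⊗[k] ⨂[k]^s V) :
    dualPw₂ r s ((TensorProduct.congr (θ.dual r) (θ.dual s)).symm f) x =
      dualPw₂ r s f (TensorProduct.congr (θ r) (θ s) x) := by
  induction f using TensorProduct.induction_on with
  | zero => simp
  | add f g hf hg => simp only [map_add, LinearMap.add_apply, hf, hg]
  | tmul f g =>
    induction x using TensorProduct.induction_on with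
    | zero => simp
    | add x y hx hy => simp only [map_add, hx, hy]
    | tmul x y =>
      simp only [TensorProduct.congr_symm_tmul, TensorProduct.congr_tmul, dualPw₂_tmul,
        dualPw_dual_symm]

theorem coboundary_dual [FiniteDimensional k V] (θ : Cochain1 k V) :
    (coboundary θ).dual = coboundary θ.dual := by
  funext r s
  ext1 f
  apply (mu (k := k) (V := Module.Dual k V) r s).injective
  apply (dualPw (k := k) (V := V) (r + s)).injective
  refine LinearMap.ext fun a => ?_
  obtain ⟨u, rfl⟩ := (mu (k := k) (V := V) r s).surjective a
  obtain ⟨w, hw⟩ := (mu (k := k) (V := V) r s).surjective ((θ (r + s)).symm (mu r s u))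
  rw [dualPw_mu, mu_coboundary, dualPw₂_dual, dualPw_dual, ← hw, dualPw_mu, dualPw₂_congr_dual]
  congr 1
  rw [LinearEquiv.symm_apply_eq]
  apply (mu (k := k) (V := V) r s).injective
  rw [mu_coboundary, LinearEquiv.symm_apply_apply, hw, LinearEquiv.apply_symm_apply]

/-- Transport of the cocycle property along an equality of cochains. -/
def Z2.copy (ψ : Z2 k V) (f : Cochain2 k V) (h : f = ψ.toFun) : Z2 k V where
  toFun := f
  counit_left := by subst h; exact ψ.counit_left
  counit_right := by subst h; exact ψ.counit_right
  cocycle := by subst h; exact ψ.cocycle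

/-- `ψ ↦ ψ^!`, from counital 2-cocycles on `V` to counital 2-cocycles on `V^*`. -/
def Z2.dual [FiniteDimensional k V] (ψ : Z2 k V) : Z2 k (Module.Dual k V) :=
  (Z2.ofCochain1 (prim ψ.toFun).dual (by
    ext1 x
    simp only [Cochain1.dual, prim, LinearEquiv.trans_apply, LinearEquiv.refl_symm,
      LinearEquiv.dualMap_refl, LinearEquiv.refl_apply, LinearEquiv.symm_apply_apply])).copy
  ψ.toFun.dual (by
    conv_lhs => rw [← coboundary_prim ψ]
    exact coboundary_dual _)

/-- `𝔧` in degree one: `θ_W ⊗ θ_V` transported by the shuffle to `(W ⊗ V)^⊗`. -/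
def Cochain1.j (θ : Cochain1 k W) (χ : Cochain1 k V) : Cochain1 k (W ⊗[k] V) := fun n =>
  shuffle n ≪≫ₗ TensorProduct.congr (θ n) (χ n) ≪≫ₗ (shuffle n).symm

/-- `𝔧 : C^2[W] × C^2[V] → C^2[W ⊗ V]`: `φ ⊗ ψ` transported by the shuffle. -/
def Cochain2.j (φ : Cochain2 k W) (ψ : Cochain2 k V) : Cochain2 k (W ⊗[k] V) := fun r s =>
  shuffle₂ r s ≪≫ₗ TensorProduct.congr (φ r s) (ψ r s) ≪≫ₗ (shuffle₂ r s).symm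

theorem shuffle₂_congr_j (θ : Cochain1 k W) (χ : Cochain1 k V) (r s : ℕ)
    (u : (⨂[k]^r (W ⊗[k] V)) ⊗[k] (⨂[k]^s (W ⊗[k] V))) :
    shuffle₂ r s (TensorProduct.congr (Cochain1.j θ χ r) (Cochain1.j θ χ s) u) =
      TensorProduct.congr (TensorProduct.congr (θ r) (θ s)) (TensorProduct.congr (χ r) (χ s))
        (shuffle₂ r s u) := by
  induction u using TensorProduct.induction_on with
  | zero => simp
  | add u v hu hv => simp only [map_add, hu, hv]
  | tmul x y =>
    simp only [shuffle₂, LinearEquiv.trans_apply, TensorProduct.congr_tmul, Cochain1.j,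
      LinearEquiv.apply_symm_apply]
    generalize shuffle r x = x
    generalize shuffle s y = y
    induction x using TensorProduct.induction_on with
    | zero => simp
    | add u v hu hv => simp only [map_add, TensorProduct.add_tmul, hu, hv]
    | tmul a b =>
      induction y using TensorProduct.induction_on with
      | zero => simp
      | add u v hu hv => simp only [map_add, TensorProduct.tmul_add, hu, hv]
      | tmul c d =>
        simp only [TensorProduct.congr_tmul, TensorProduct.tensorTensorTensorComm_tmul]

theorem coboundary_j (θ : Cochain1 k W) (χ : Cochain1 k V) :
    Cochain2.j (coboundary θ) (coboundary χ) = coboundary (Cochain1.j θ χ) := by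
  funext r s
  ext1 u
  obtain ⟨u, rfl⟩ := (TensorProduct.congr (Cochain1.j θ χ r) (Cochain1.j θ χ s)).surjective u
  apply (mu (k := k) (V := W ⊗[k] V) r s).injective
  apply (shuffle (k := k) (W := W) (V := V) (r + s)).injective
  rw [mu_coboundary, LinearEquiv.symm_apply_apply, shuffle_mu]
  simp only [Cochain2.j, Cochain1.j, LinearEquiv.trans_apply, LinearEquiv.apply_symm_apply]
  rw [shuffle_mu]
  have := shuffle₂_congr_j θ χ r s u
  simp only [Cochain1.j] at this
  rw [this]
  generalize shuffle₂ r s u = w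
  induction w using TensorProduct.induction_on with
  | zero => simp
  | add u v hu hv => simp only [map_add, hu, hv]
  | tmul a b =>
    simp only [TensorProduct.congr_tmul, TensorProduct.map_tmul, LinearEquiv.coe_coe,
      mu_coboundary, LinearEquiv.symm_apply_apply]

/-- `𝔧(φ, ψ)` for counital 2-cocycles `φ` on `W` and `ψ` on `V`, a counital 2-cocycle on
`W ⊗ V`. -/
def Z2.j (φ : Z2 k W) (ψ : Z2 k V) : Z2 k (W ⊗[k] V) :=
  (Z2.ofCochain1 (Cochain1.j (prim φ.toFun) (prim ψ.toFun)) (by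
    ext1 x
    simp only [Cochain1.j, prim, LinearEquiv.trans_apply, TensorProduct.congr_refl_refl,
      LinearEquiv.refl_apply, LinearEquiv.symm_apply_apply])).copy
  (Cochain2.j φ.toFun ψ.toFun) (by
    conv_lhs => rw [← coboundary_prim φ, ← coboundary_prim ψ]
    exact coboundary_j _ _)

/-- `𝔧(φ, ψ, χ)`, a counital 2-cocycle on `(W ⊗ V) ⊗ U`. -/
def Z2.j₃ {U : Type u} [AddCommGroup U] [Module k U] (φ : Z2 k W) (ψ : Z2 k V) (χ : Z2 k U) :
    Z2 k ((W ⊗[k] V) ⊗[k] U) :=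
  (φ.j ψ).j χ

end Cochains

/-! ### Conic quantum spaces -/

section Objects

/-- Two-sided graded ideals `I = ⨁ Iₙ` of the tensor algebra `V^⊗`. -/
@[ext] structure GIdeal (k V : Type u) [Field k] [AddCommGroup V] [Module k V] where
  deg : ∀ n : ℕ, Submodule k (⨂[k]^n V)
  mul_left : ∀ (r s : ℕ) (x : ⨂[k]^r V) (y : ⨂[k]^s V), y ∈ deg s → mu r s (x ⊗ₜ y) ∈ deg (r + s)
  mul_right : ∀ (r s : ℕ) (x : ⨂[k]^r V) (y : ⨂[k]^s V),
    x ∈ deg r → mu r s (x ⊗ₜ y) ∈ deg (r + s)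

/-- The two-sided graded ideal generated by subspaces `Rₙ ⊆ V^{⊗n}`: the intersection of all the
graded ideals that contain them. -/
def GIdeal.gen {k V : Type u} [Field k] [AddCommGroup V] [Module k V]
    (R : ∀ n : ℕ, Submodule k (⨂[k]^n V)) : GIdeal k V where
  deg n := ⨅ (J : GIdeal k V) (_ : ∀ m, R m ≤ J.deg m), J.deg n
  mul_left r s x y hy := by
    simp only [Submodule.mem_iInf] at hy ⊢
    exact fun J hJ => J.mul_left r s x y (hy J hJ)
  mul_right r s x y hx := by
    simp only [Submodule.mem_iInf] at hx ⊢
    exact fun J hJ => J.mul_right r s x y (hx J hJ)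

/-- The graded ideal `⨁_{n ≥ 2} V^{⊗n}`. -/
def GIdeal.geTwo (k V : Type u) [Field k] [AddCommGroup V] [Module k V] : GIdeal k V where
  deg n := if 2 ≤ n then ⊤ else ⊥
  mul_left r s x y hy := by
    by_cases hs : 2 ≤ s
    · rw [if_pos (by omega)]; trivial
    · rw [if_neg hs, Submodule.mem_bot] at hy
      rw [hy, TensorProduct.tmul_zero, map_zero]
      exact Submodule.zero_mem _
  mul_right r s x y hx := by
    by_cases hr : 2 ≤ r
    · rw [if_pos (by omega)]; trivial
    · rw [if_neg hr, Submodule.mem_bot] at hx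
      rw [hx, TensorProduct.zero_tmul, map_zero]
      exact Submodule.zero_mem _

theorem GIdeal.gen_eq_bot {k V : Type u} [Field k] [AddCommGroup V] [Module k V]
    (R : ∀ n : ℕ, Submodule k (⨂[k]^n V)) (h0 : R 0 = ⊥) (h1 : R 1 = ⊥) {n : ℕ} (hn : n < 2) :
    (GIdeal.gen R).deg n = ⊥ := by
  rw [eq_bot_iff]
  refine (iInf₂_le (GIdeal.geTwo k V) ?_).trans ?_
  · intro m
    match m with
    | 0 => rw [h0]; exact bot_le
    | 1 => rw [h1]; exact bot_le
    | m + 2 => exact le_top.trans_eq (if_pos (show 2 ≤ m + 2 by omega) : (if 2 ≤ m + 2 then ⊤ else ⊥) = ⊤).symm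
  · exact (if_neg (by omega) : (if 2 ≤ n then ⊤ else ⊥) = _).le

/-- A conic quantum space `𝒜 = (𝐀₁, 𝐀)` over `k`: a finite dimensional vector space `V = 𝐀₁` of
generators and the graded ideal `I = ⨁_{n ≥ 2} Iₙ` of relations, with `𝐀 = 𝐀₁^⊗ / I`. -/
structure CA (k : Type u) [Field k] where
  V : Type u
  [addCommGroup : AddCommGroup V]
  [module : Module k V]
  [finite : FiniteDimensional k V]
  I : GIdeal k V
  I_zero : I.deg 0 = ⊥
  I_one : I.deg 1 = ⊥

attribute [instance] CA.addCommGroup CA.module CA.finite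

variable {k : Type u} [Field k]

namespace CA

/-- The homogeneous component `𝐀ₙ = 𝐀₁^{⊗n} / Iₙ`. -/
abbrev Comp (A : CA k) (n : ℕ) : Type u := (⨂[k]^n A.V) ⧸ A.I.deg n

/-- The projection `𝐀₁^{⊗n} → 𝐀ₙ`. -/
abbrev proj (A : CA k) (n : ℕ) : (⨂[k]^n A.V) →ₗ[k] A.Comp n := (A.I.deg n).mkQ

/-- The unit of `𝐀`. -/
def unit (A : CA k) : A.Comp 0 := A.proj 0 (tone k A.V)

/-- The identification of the space of generators with `𝐀₁^{⊗1} / I₁`. -/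
def genEquiv (A : CA k) : A.V ≃ₗ[k] A.Comp 1 :=
  pwOne.symm ≪≫ₗ (Submodule.quotEquivOfEqBot (A.I.deg 1) A.I_one).symm

/-- The kernel of `𝐀₁^{⊗r} ⊗ 𝐀₁^{⊗s} → 𝐀ᵣ ⊗ 𝐀ₛ`, that is
`Iᵣ ⊗ 𝐀₁^{⊗s} + 𝐀₁^{⊗r} ⊗ Iₛ`. -/
abbrev rel₂ (A : CA k) (r s : ℕ) : Submodule k ((⨂[k]^r A.V) ⊗[k] ⨂[k]^s A.V) :=
  LinearMap.ker (TensorProduct.map (A.proj r) (A.proj s))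

theorem map_proj_surjective (A : CA k) (r s : ℕ) :
    Function.Surjective (TensorProduct.map (A.proj r) (A.proj s)) :=
  TensorProduct.map_surjective (Submodule.mkQ_surjective _) (Submodule.mkQ_surjective _)

theorem rel₂_le (A : CA k) (r s : ℕ) :
    A.rel₂ r s ≤ LinearMap.ker (A.proj (r + s) ∘ₗ (mu r s).toLinearMap) := by
  rw [rel₂, TensorProduct.map_ker (LinearMap.exact_subtype_mkQ (A.I.deg r))
    (Submodule.mkQ_surjective _) (LinearMap.exact_subtype_mkQ (A.I.deg s))
    (Submodule.mkQ_surjective _), sup_le_iff, LinearMap.range_le_ker_iff,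
    LinearMap.range_le_ker_iff]
  constructor
  · apply TensorProduct.ext'
    intro x y
    exact (Submodule.Quotient.mk_eq_zero _).2 (A.I.mul_left r s x y.1 y.2)
  · apply TensorProduct.ext'
    intro x y
    exact (Submodule.Quotient.mk_eq_zero _).2 (A.I.mul_right r s x.1 y x.2)

/-- `ψ` is `𝒜`-admissible: it induces automorphisms of the spaces `𝐀ᵣ ⊗ 𝐀ₛ`. -/
def Admissible (A : CA k) (ψ : Cochain2 k A.V) : Prop :=
  ∀ r s : ℕ, (A.rel₂ r s).map (ψ r s).toLinearMap = A.rel₂ r s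

theorem proj_mu_eq_zero (A : CA k) {ψ : Cochain2 k A.V}
    (h : A.Admissible ψ) {r s : ℕ}
    {u : (⨂[k]^r A.V) ⊗[k] ⨂[k]^s A.V} (hu : u ∈ A.rel₂ r s) :
    A.proj (r + s) (mu r s (ψ r s u)) = 0 := by
  have : ψ r s u ∈ A.rel₂ r s := by
    rw [← h r s]
    exact Submodule.mem_map_of_mem hu
  exact A.rel₂_le r s this

/-- The subspace `P ⊗ Q` of `M ⊗ N`. -/
abbrev tens {M N : Type u} [AddCommMonoid M] [Module k M] [AddCommMonoid N] [Module k N]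
    (P : Submodule k M) (Q : Submodule k N) : Submodule k (M ⊗[k] N) :=
  Submodule.map₂ (TensorProduct.mk k M N) P Q

/-- The subspace `𝐀₁^{⊗i} ⊗ I_m ⊗ 𝐀₁^{⊗j}` of `𝐀₁^{⊗(i+m+j)}`. -/
def slot (A : CA k) (i m j : ℕ) : Submodule k (⨂[k]^(i + m + j) A.V) :=
  (tens ((tens (⊤ : Submodule k (⨂[k]^i A.V)) (A.I.deg m)).map (mu i m).toLinearMap)
    (⊤ : Submodule k (⨂[k]^j A.V))).map (mu (i + m) j).toLinearMap

/-- `ψ` is 2nd `𝒜`-admissible: it is `𝒜`-admissible and, in either tensor factor of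
`𝐀₁^⊗ ⊗ 𝐀₁^⊗`, it preserves each of the subspaces `𝐀₁^{⊗i} ⊗ I_m ⊗ 𝐀₁^{⊗j}` individually. -/
def SecondAdmissible (A : CA k) (ψ : Cochain2 k A.V) : Prop :=
  A.Admissible ψ ∧ ∀ i m j s : ℕ,
    (tens (A.slot i m j) (⊤ : Submodule k (⨂[k]^s A.V))).map (ψ (i + m + j) s).toLinearMap =
      tens (A.slot i m j) ⊤ ∧
    (tens (⊤ : Submodule k (⨂[k]^s A.V)) (A.slot i m j)).map (ψ s (i + m + j)).toLinearMap =
      tens ⊤ (A.slot i m j)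

/-- The twisted product `m_ψ = m ∘ ψ` on `𝐀`, in degrees `r`, `s`. -/
def twMul (A : CA k) (ψ : Cochain2 k A.V) (h : A.Admissible ψ) (r s : ℕ) :
    A.Comp r ⊗[k] A.Comp s →ₗ[k] A.Comp (r + s) :=
  (A.rel₂ r s).liftQ (A.proj (r + s) ∘ₗ (mu r s).toLinearMap ∘ₗ (ψ r s).toLinearMap) (fun _ hu => A.proj_mu_eq_zero h hu) ∘ₗ
  (LinearMap.quotKerEquivOfSurjective _ (A.map_proj_surjective r s)).symm.toLinearMap

theorem twMul_proj (A : CA k) (ψ : Cochain2 k A.V) (h : A.Admissible ψ) (r s : ℕ)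
    (u : (⨂[k]^r A.V) ⊗[k] ⨂[k]^s A.V) :
    A.twMul ψ h r s (TensorProduct.map (A.proj r) (A.proj s) u) =
      A.proj (r + s) (mu r s (ψ r s u)) := by
  rw [twMul, LinearMap.comp_apply, LinearEquiv.coe_coe]
  have : (LinearMap.quotKerEquivOfSurjective _ (A.map_proj_surjective r s)).symm
      (TensorProduct.map (A.proj r) (A.proj s) u) = Submodule.Quotient.mk u := by
    rw [LinearEquiv.symm_apply_eq]
    rfl
  rw [this]
  rfl

theorem admissible_one (A : CA k) : A.Admissible (Z2.one k A.V).toFun := by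
  intro r s
  exact Submodule.map_id _

/-- The product of `𝐀`. -/
def mul (A : CA k) (r s : ℕ) : A.Comp r ⊗[k] A.Comp s →ₗ[k] A.Comp (r + s) :=
  A.twMul _ A.admissible_one r s

/-- `φ : 𝐀 → 𝐂` (homogeneous linear) is a morphism of quantum spaces `𝒜 → 𝒞_ψ`: it carries the
unit to the unit and the product of `𝐀` to the twisted product of `𝐂`. -/
def IsHomToTwist (A C : CA k) (ψ : Cochain2 k C.V) (h : C.Admissible ψ)
    (φ : ∀ n, A.Comp n →ₗ[k] C.Comp n) : Prop :=
  φ 0 A.unit = C.unit ∧ ∀ (r s : ℕ) (x : A.Comp r) (y : A.Comp s),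
    φ (r + s) (A.mul r s (x ⊗ₜ y)) = C.twMul ψ h r s (φ r x ⊗ₜ φ s y)

/-- The twisting `𝒜_ψ` as a conic quantum space: the algebra `(𝐀, m_ψ)` is generated by `𝐀₁`,
and its relations in degree `n` are the kernel of
`v₁ ⊗ ⋯ ⊗ vₙ ↦ v₁ ·_ψ ⋯ ·_ψ vₙ = [prim ψ (v₁ ⊗ ⋯ ⊗ vₙ)] ∈ 𝐀ₙ`. See `twistEquiv`. -/
def twist (A : CA k) (ψ : Z2 k A.V) (h : A.Admissible ψ.toFun) : CA k where
  V := A.V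
  I :=
    { deg := fun n => LinearMap.ker (A.proj n ∘ₗ (prim ψ.toFun n).toLinearMap)
      mul_left := fun r s x y hy => by
        rw [LinearMap.mem_ker, LinearMap.comp_apply, LinearEquiv.coe_coe] at hy ⊢
        rw [← prim_mu]
        apply A.proj_mu_eq_zero h
        rw [rel₂, LinearMap.mem_ker, TensorProduct.map_tmul, hy, TensorProduct.tmul_zero]
      mul_right := fun r s x y hx => by
        rw [LinearMap.mem_ker, LinearMap.comp_apply, LinearEquiv.coe_coe] at hx ⊢
        rw [← prim_mu]
        apply A.proj_mu_eq_zero h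
        rw [rel₂, LinearMap.mem_ker, TensorProduct.map_tmul, hx, TensorProduct.zero_tmul] }
  I_zero := by
    change LinearMap.ker (A.proj 0 ∘ₗ (prim ψ.toFun 0).toLinearMap) = ⊥
    rw [LinearMap.ker_comp, Submodule.ker_mkQ, A.I_zero]
    exact LinearEquiv.ker _
  I_one := by
    change LinearMap.ker (A.proj 1 ∘ₗ (prim ψ.toFun 1).toLinearMap) = ⊥
    rw [LinearMap.ker_comp, Submodule.ker_mkQ, A.I_one]
    exact LinearEquiv.ker _

/-- The canonical identification of the graded spaces of `𝒜_ψ` and `𝒜`. -/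
def twistEquiv (A : CA k) (ψ : Z2 k A.V) (h : A.Admissible ψ.toFun) (n : ℕ) :
    (A.twist ψ h).Comp n ≃ₗ[k] A.Comp n :=
  LinearMap.quotKerEquivOfSurjective (A.proj n ∘ₗ (prim ψ.toFun n).toLinearMap)
    ((Submodule.mkQ_surjective _).comp (prim ψ.toFun n).surjective)

theorem twistEquiv_proj (A : CA k) (ψ : Z2 k A.V) (h : A.Admissible ψ.toFun) (n : ℕ)
    (x : ⨂[k]^n A.V) :
    A.twistEquiv ψ h n ((A.twist ψ h).proj n x) = A.proj n (prim ψ.toFun n x) := rfl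

theorem twistEquiv_gen (A : CA k) (ψ : Z2 k A.V) (h : A.Admissible ψ.toFun) (v : A.V) :
    A.twistEquiv ψ h 1 ((A.twist ψ h).genEquiv v) = A.genEquiv v := by
  change A.proj 1 (prim ψ.toFun 1 (pwOne.symm v)) = A.proj 1 (pwOne.symm v)
  rw [prim_one]

theorem twistEquiv_mul (A : CA k) (ψ : Z2 k A.V) (h : A.Admissible ψ.toFun) (r s : ℕ)
    (x : (A.twist ψ h).Comp r) (y : (A.twist ψ h).Comp s) :
    A.twistEquiv ψ h (r + s) ((A.twist ψ h).mul r s (x ⊗ₜ y)) =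
      A.twMul ψ.toFun h r s (A.twistEquiv ψ h r x ⊗ₜ A.twistEquiv ψ h s y) := by
  obtain ⟨x, rfl⟩ := Submodule.mkQ_surjective _ x
  obtain ⟨y, rfl⟩ := Submodule.mkQ_surjective _ y
  have h1 := (A.twist ψ h).twMul_proj _ (A.twist ψ h).admissible_one r s (x ⊗ₜ y)
  have h2 := A.twMul_proj _ h r s (prim ψ.toFun r x ⊗ₜ prim ψ.toFun s y)
  rw [TensorProduct.map_tmul] at h1 h2
  rw [mul, h1]
  refine Eq.trans ?_ h2.symm
  exact congrArg (A.proj (r + s)) (prim_mu ψ r s x y).symm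

/-! ### The product `∘`, the coHom `▷`, the unit `𝒦` -/

theorem mul_proj (A : CA k) (r s : ℕ) (x : ⨂[k]^r A.V) (y : ⨂[k]^s A.V) :
    A.mul r s (A.proj r x ⊗ₜ A.proj s y) = A.proj (r + s) (mu r s (x ⊗ₜ y)) :=
  A.twMul_proj _ A.admissible_one r s (x ⊗ₜ y)

theorem circ_mul_aux (A B : CA k) (r s : ℕ) (x : ⨂[k]^r (A.V ⊗[k] B.V))
    (y : ⨂[k]^s (A.V ⊗[k] B.V)) :
    TensorProduct.map (A.proj (r + s)) (B.proj (r + s)) (shuffle (r + s) (mu r s (x ⊗ₜ y))) =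
      TensorProduct.map (A.mul r s) (B.mul r s) (TensorProduct.tensorTensorTensorComm k _ _ _ _
        (TensorProduct.map (A.proj r) (B.proj r) (shuffle r x) ⊗ₜ
          TensorProduct.map (A.proj s) (B.proj s) (shuffle s y))) := by
  rw [shuffle_mu]
  simp only [shuffle₂, LinearEquiv.trans_apply, TensorProduct.congr_tmul]
  generalize shuffle r x = x
  generalize shuffle s y = y
  induction x using TensorProduct.induction_on with
  | zero => simp
  | add u v hu hv => simp only [map_add, TensorProduct.add_tmul, hu, hv]
  | tmul a b =>
    induction y using TensorProduct.induction_on with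
    | zero => simp
    | add u v hu hv => simp only [map_add, TensorProduct.tmul_add, hu, hv]
    | tmul c d =>
      simp only [TensorProduct.map_tmul, TensorProduct.tensorTensorTensorComm_tmul, mul_proj,
        LinearEquiv.coe_coe]

theorem circ_ker_eq_bot (A B : CA k) {n : ℕ} (hA : A.I.deg n = ⊥) (hB : B.I.deg n = ⊥) :
    LinearMap.ker (TensorProduct.map (A.proj n) (B.proj n) ∘ₗ
      (shuffle (k := k) (W := A.V) (V := B.V) n).toLinearMap) = ⊥ := by
  rw [LinearMap.ker_eq_bot, LinearMap.coe_comp]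
  refine Function.Injective.comp ?_ (shuffle n).injective
  apply TensorProduct.map_injective_of_flat_flat
  · rw [← LinearMap.ker_eq_bot, Submodule.ker_mkQ, hA]
  · rw [← LinearMap.ker_eq_bot, Submodule.ker_mkQ, hB]

/-- `𝒜 ∘ ℬ`, with algebra `⨁ₙ 𝐀ₙ ⊗ 𝐁ₙ`: it is generated by `𝐀₁ ⊗ 𝐁₁`, and its relations in
degree `n` are the kernel of `(𝐀₁ ⊗ 𝐁₁)^{⊗n} ≃ 𝐀₁^{⊗n} ⊗ 𝐁₁^{⊗n} → 𝐀ₙ ⊗ 𝐁ₙ`. -/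
def circ (A B : CA k) : CA k where
  V := A.V ⊗[k] B.V
  I :=
    { deg := fun n => LinearMap.ker (TensorProduct.map (A.proj n) (B.proj n) ∘ₗ
        (shuffle n).toLinearMap)
      mul_left := fun r s x y hy => by
        rw [LinearMap.mem_ker, LinearMap.comp_apply, LinearEquiv.coe_coe] at hy ⊢
        rw [circ_mul_aux, hy, TensorProduct.tmul_zero, map_zero, map_zero]
      mul_right := fun r s x y hx => by
        rw [LinearMap.mem_ker, LinearMap.comp_apply, LinearEquiv.coe_coe] at hx ⊢
        rw [circ_mul_aux, hx, TensorProduct.zero_tmul, map_zero, map_zero] }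
  I_zero := circ_ker_eq_bot A B A.I_zero B.I_zero
  I_one := circ_ker_eq_bot A B A.I_one B.I_one

/-- The annihilator `Jₙ^⊥ ⊆ (𝐁₁^*)^{⊗n}` of the relations of `ℬ` in degree `n`. -/
def perp (B : CA k) (n : ℕ) : Submodule k (⨂[k]^n (Module.Dual k B.V)) :=
  (B.I.deg n).dualAnnihilator.comap (dualPw n).toLinearMap

/-- The subspace `Jₙ^⊥ ⊗ Iₙ`, transported to `(𝐁₁^* ⊗ 𝐀₁)^{⊗n}`. -/
def triRel (B A : CA k) (n : ℕ) : Submodule k (⨂[k]^n (Module.Dual k B.V ⊗[k] A.V)) :=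
  (tens (B.perp n) (A.I.deg n)).comap (shuffle n).toLinearMap

theorem triRel_eq_bot (B A : CA k) {n : ℕ} (h : A.I.deg n = ⊥) : B.triRel A n = ⊥ := by
  rw [triRel, h, tens, Submodule.map₂_bot_right]
  exact LinearEquiv.ker _

/-- `ℬ ▷ 𝒜`: generated by `𝐁₁^* ⊗ 𝐀₁`, with the ideal generated by `⨁ₙ Jₙ^⊥ ⊗ Iₙ`, where `I` and
`J` are the ideals of `𝒜` and `ℬ`. -/
def tri (B A : CA k) : CA k where
  V := Module.Dual k B.V ⊗[k] A.V
  I := GIdeal.gen (B.triRel A)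
  I_zero := GIdeal.gen_eq_bot _ (triRel_eq_bot B A A.I_zero) (triRel_eq_bot B A A.I_one)
    (by norm_num)
  I_one := GIdeal.gen_eq_bot _ (triRel_eq_bot B A A.I_zero) (triRel_eq_bot B A A.I_one)
    (by norm_num)

/-- The space `𝐁₁^* ⊗ 𝐀₁` of generators of `ℬ ▷ 𝒜`. -/
abbrev D₁ (B A : CA k) : Type u := (B.tri A).V

/-- The unit `𝒦 = k[e]` of `∘`. -/
def unitObj (k : Type u) [Field k] : CA k where
  V := k
  I :=
    { deg := fun _ => ⊥
      mul_left := fun r s x y hy => by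
        rw [Submodule.mem_bot] at hy ⊢
        rw [hy, TensorProduct.tmul_zero, map_zero]
      mul_right := fun r s x y hx => by
        rw [Submodule.mem_bot] at hx ⊢
        rw [hx, TensorProduct.zero_tmul, map_zero] }
  I_zero := rfl
  I_one := rfl

theorem pw_injective {V W : Type u} [AddCommGroup V] [Module k V] [AddCommGroup W] [Module k W]
    (f : V →ₗ[k] W) (hf : Function.Injective f) (n : ℕ) : Function.Injective (pw f n) := by
  obtain ⟨g, hg⟩ := f.exists_leftInverse_of_injective (LinearMap.ker_eq_bot.2 hf)
  intro x y hxy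
  have := congrArg (pw g n) hxy
  rwa [← LinearMap.comp_apply, ← LinearMap.comp_apply, ← pw_comp, hg, pw_id] at this

/-- The subalgebra of `𝐀` generated by a subspace `U` of `𝐀₁`, as a conic quantum space. -/
def sub (A : CA k) (U : Submodule k A.V) : CA k where
  V := U
  I :=
    { deg := fun n => (A.I.deg n).comap (pw U.subtype n)
      mul_left := fun r s x y hy => by
        rw [Submodule.mem_comap] at hy ⊢
        rw [pw_mu]
        exact A.I.mul_left r s _ _ hy
      mul_right := fun r s x y hx => by
        rw [Submodule.mem_comap] at hx ⊢
        rw [pw_mu]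
        exact A.I.mul_right r s _ _ hx }
  I_zero := by
    change (A.I.deg 0).comap (pw U.subtype 0) = ⊥
    rw [A.I_zero]
    exact LinearMap.ker_eq_bot.2 (pw_injective _ U.injective_subtype 0)
  I_one := by
    change (A.I.deg 1).comap (pw U.subtype 1) = ⊥
    rw [A.I_one]
    exact LinearMap.ker_eq_bot.2 (pw_injective _ U.injective_subtype 1)

/-! ### The category of conic quantum spaces and its forgetful functor -/

/-- Morphisms of quantum spaces, i.e. algebra morphisms that map generators to generators: linear
maps of the spaces of generators that carry relations to relations. -/
@[ext] structure Hom (A B : CA k) where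
  lin : A.V →ₗ[k] B.V
  map_rel : ∀ n, A.I.deg n ≤ (B.I.deg n).comap (pw lin n)

instance : Category (CA k) where
  Hom := Hom
  id A := ⟨LinearMap.id, fun n => by rw [pw_id]; exact le_rfl⟩
  comp f g := ⟨g.lin ∘ₗ f.lin, fun n => by
    rw [pw_comp]
    exact (f.map_rel n).trans (Submodule.comap_mono (g.map_rel n))⟩
  id_comp _ := Hom.ext rfl
  comp_id _ := Hom.ext rfl
  assoc _ _ _ := Hom.ext rfl

/-- The map `𝐀ₙ → 𝐁ₙ` induced by a morphism `𝒜 → ℬ`. -/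
def Hom.onComp {A B : CA k} (f : Hom A B) (n : ℕ) : A.Comp n →ₗ[k] B.Comp n :=
  (A.I.deg n).mapQ (B.I.deg n) (pw f.lin n) (f.map_rel n)

/-- The forgetful functor `ℌ : CA ⥤ GrVct`. -/
def forgetGr (k : Type u) [Field k] : CA k ⥤ GradedObject ℕ (ModuleCat.{u} k) where
  obj A n := ModuleCat.of k (A.Comp n)
  map f n := ModuleCat.ofHom (Hom.onComp f n)
  map_id A := by
    funext n
    apply ModuleCat.hom_ext
    apply Submodule.linearMap_qext
    ext1
    ext1 x
    change A.proj n (pw LinearMap.id n _) = A.proj n _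
    rw [pw_id]
    rfl
  map_comp {A B C} f g := by
    funext n
    apply ModuleCat.hom_ext
    apply Submodule.linearMap_qext
    ext1
    ext1 x
    change C.proj n (pw (Hom.lin g ∘ₗ Hom.lin f) n _) =
      C.proj n (pw (Hom.lin g) n (pw (Hom.lin f) n _))
    rw [pw_comp]
    rfl

/-- `α ∘ id : ℋ ∘ ℬ → ℋ' ∘ ℬ` for a morphism `α : ℋ → ℋ'`. -/
def Hom.circRight {H H' : CA k} (f : Hom H H') (B : CA k) : Hom (H.circ B) (H'.circ B) where
  lin := TensorProduct.map f.lin LinearMap.id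
  map_rel n x hx := by
    have key : ∀ u : (⨂[k]^n H.V) ⊗[k] ⨂[k]^n B.V,
        TensorProduct.map (H'.proj n) (B.proj n)
          (TensorProduct.map (pw f.lin n) (pw LinearMap.id n) u) =
        TensorProduct.map (f.onComp n) LinearMap.id
          (TensorProduct.map (H.proj n) (B.proj n) u) := by
      intro u
      induction u using TensorProduct.induction_on with
      | zero => simp
      | add u v hu hv => simp only [map_add, hu, hv]
      | tmul a b =>
        rw [pw_id]
        rfl
    change TensorProduct.map (H.proj n) (B.proj n) (shuffle n x) = 0 at hx
    change TensorProduct.map (H'.proj n) (B.proj n)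
      (shuffle n (pw (TensorProduct.map f.lin LinearMap.id) n x)) = 0
    have h2 := shuffle_pw f.lin (LinearMap.id : B.V →ₗ[k] B.V) n x
    exact (congrArg _ h2).trans ((key _).trans ((congrArg _ hx).trans (map_zero _)))

/-- The functor `CA ∘ ℬ : ℋ ↦ ℋ ∘ ℬ`, `α ↦ α ∘ id`. -/
def circRight (B : CA k) : CA k ⥤ CA k where
  obj H := H.circ B
  map f := Hom.circRight f B
  map_id _ := Hom.ext TensorProduct.map_id
  map_comp f g := Hom.ext
    (TensorProduct.map_comp (Hom.lin g) LinearMap.id (Hom.lin f) LinearMap.id)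

/-- The inclusion of the subalgebra generated by `U`. -/
def incl (A : CA k) (U : Submodule k A.V) : Hom (A.sub U) A :=
  ⟨U.subtype, fun _ => le_rfl⟩

/-! ### The categories `Ω^{𝒜,ℬ}` -/

/-- The comma category `(ℌ(𝒜) ↓ ℌ(CA ∘ ℬ))`. -/
abbrev HComma (A B : CA k) : Type (u + 1) :=
  StructuredArrow ((forgetGr k).obj A) (circRight B ⋙ forgetGr k)

/-- The component `φₙ : 𝐀ₙ → 𝐇ₙ ⊗ 𝐁ₙ` of a diagram `⟨φ, ℋ⟩`. -/
def HComma.φ {A B : CA k} (X : HComma A B) (n : ℕ) : A.Comp n →ₗ[k] (X.right.circ B).Comp n :=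
  (X.hom n).hom

/-- `φ` in degree one, `𝐀₁ → 𝐇₁ ⊗ 𝐁₁`. -/
def HComma.φ₁ {A B : CA k} (X : HComma A B) : A.V →ₗ[k] X.right.V ⊗[k] B.V :=
  (X.right.circ B).genEquiv.symm.toLinearMap ∘ₗ X.φ 1 ∘ₗ A.genEquiv.toLinearMap

/-- `𝐁₁^* ⊗ 𝐀₁ → 𝐇₁`, `b^j ⊗ a_i ↦ h_i^j`, where `φ(a_i) = ∑_j h_i^j ⊗ b_j`; that is,
`f ⊗ a ↦ (id ⊗ f)(φ(a))`. -/
def HComma.coeff {A B : CA k} (X : HComma A B) : Module.Dual k B.V ⊗[k] A.V →ₗ[k] X.right.V :=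
  TensorProduct.lift (LinearMap.lcomp k X.right.V X.φ₁ ∘ₗ
    LinearMap.compRight k (TensorProduct.rid k X.right.V).toLinearMap ∘ₗ
    LinearMap.lTensorHom X.right.V)

theorem HComma.coeff_tmul {A B : CA k} (X : HComma A B) (f : Module.Dual k B.V) (a : A.V) :
    X.coeff (f ⊗ₜ a) = TensorProduct.rid k X.right.V (LinearMap.lTensor X.right.V f (X.φ₁ a)) :=
  rfl

/-- `𝐇₁^φ ⊆ 𝐇₁`, the span of the `h_i^j`. -/
def HComma.H₁ {A B : CA k} (X : HComma A B) : Submodule k X.right.V := LinearMap.range X.coeff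

/-- `𝔉⟨φ, ℋ⟩ = ℋ^φ`, the subalgebra of `𝐇` generated by `𝐇₁^φ`. -/
def HComma.F {A B : CA k} (X : HComma A B) : CA k := X.right.sub X.H₁

/-- The surjection `π^φ : 𝐁₁^* ⊗ 𝐀₁ ↠ 𝐇₁^φ`. -/
def HComma.π {A B : CA k} (X : HComma A B) : B.D₁ A →ₗ[k] X.F.V :=
  X.coeff.rangeRestrict

/-- `ω̄` is the translation of `ω` to `𝐇₁^φ ⊗ 𝐁₁` through `π^φ`:
`ω̄ ∘ (π^φ ⊗ id)^{⊗} = (π^φ ⊗ id)^{⊗} ∘ ω`. -/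
def HComma.Translates {A B : CA k} (X : HComma A B)
    (ω : Z2 k (B.D₁ A ⊗[k] B.V)) (ω' : Z2 k (X.F.circ B).V) : Prop :=
  ∀ (r s : ℕ) (u : (⨂[k]^r (B.D₁ A ⊗[k] B.V)) ⊗[k]
      ⨂[k]^s (B.D₁ A ⊗[k] B.V)),
    let p : B.D₁ A ⊗[k] B.V →ₗ[k] (X.F.circ B).V :=
      TensorProduct.map X.π LinearMap.id
    ω'.toFun r s (TensorProduct.map (pw p r) (pw p s) u) =
      TensorProduct.map (pw p r) (pw p s) (ω.toFun r s u)

/-- The objects of `Ω^{𝒜,ℬ}`: diagrams `⟨φ, ℋ⟩` such that `ω` translates to a counital 2-cocycle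
on `𝐇₁^φ ⊗ 𝐁₁` admissible for `ℋ^φ ∘ ℬ`, and such that `φ` takes values in `ℋ^φ ∘ ℬ` and is a
morphism of quantum spaces `𝒜 → (ℋ^φ ∘ ℬ)_ω`. -/
def IsOmega {A B : CA k} (ω : Z2 k (B.D₁ A ⊗[k] B.V)) :
    ObjectProperty (HComma A B) := fun X =>
  ∃ (ω' : Z2 k (X.F.circ B).V) (_ : X.Translates ω ω')
    (h : (X.F.circ B).Admissible ω'.toFun)
    (φ' : ∀ n, A.Comp n →ₗ[k] (X.F.circ B).Comp n),
      (∀ n, ((X.right.incl X.H₁).circRight B).onComp n ∘ₗ φ' n = X.φ n) ∧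
      IsHomToTwist A (X.F.circ B) ω'.toFun h φ'

/-- The category `Ω^{𝒜,ℬ}` defined by `ω`, a full subcategory of `(ℌ(𝒜) ↓ ℌ(CA ∘ ℬ))`. -/
abbrev Omega (A B : CA k) (ω : Z2 k (B.D₁ A ⊗[k] B.V)) : Type (u + 1) :=
  (IsOmega (A := A) (B := B) ω).FullSubcategory

/-- The quantum space `ℋ` of an object `⟨φ, ℋ⟩` of `Ω^{𝒜,ℬ}`. -/
abbrev Omega.space {A B : CA k} {ω : Z2 k (B.D₁ A ⊗[k] B.V)}
    (X : Omega A B ω) : CA k := X.obj.right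

/-- The collection `ω` is factorizable, and given by the collection `ψ`:
`ω_{𝒜,ℬ} = 𝔧(ψ_ℬ^!, ψ_𝒜, 𝕀^{⊗2})`. -/
def FactorizedBy (ω : ∀ A B : CA k, Z2 k (B.D₁ A ⊗[k] B.V))
    (ψ : ∀ A : CA k, Z2 k A.V) : Prop :=
  ∀ A B : CA k, ω A B = Z2.j₃ (ψ B).dual (ψ A) (Z2.one k B.V)

end CA

end Objects

end QSpace

end

noncomputable section

namespace QSpace

open CA

/-! ### Products of subspaces of tensor powers -/

section Products

variable {k : Type u} [Field k] {V W M N : Type u} [AddCommGroup V] [Module k V]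
  [AddCommGroup W] [Module k W] [AddCommGroup M] [Module k M] [AddCommGroup N] [Module k N]

/-! Write `ψ = ∂θ` with `θ = prim ψ`. Twisting by `𝔦ψ = ∂(θ⁻¹)` keeps the generators and replaces
the relations `Iₙ` by `θₙ(Iₙ)` (`twist_inv_deg`), so every assertion about twisted spaces becomes
one about subspaces of tensor powers moved by `θ`.

Universal property. A morphism `φ` from `𝒜` to a twist of `ℋ^φ ∘ ℬ` is determined in degree one, and
on products of generators it is the primitive of the cocycle applied to `φ₁^{⊗n}`
(`IsHomToTwist.proj`). Now `φ₁` is the coevaluation `a ↦ ∑ⱼ (bʲ ⊗ a) ⊗ bⱼ` followed by `π^φ ⊗ id`,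
and primitives commute with maps that intertwine the cocycles (`prim_pw`). An element vanishes in
`𝐇ₙ ⊗ 𝐁ₙ` exactly when its contractions with all of `Jₙ^⊥` vanish in `𝐇ₙ` (`mem_circ_deg`). Since
`ω` is the identity on the last factor `𝐁₁`, contracting the image of a relation `x ∈ Iₙ` with `F ∈
Jₙ^⊥` gives the image of `Θ(F ⊗ x)`, where `Θ = θ_ℬ^! ⊗ θ_𝒜` (`contract_shuffle_coev`). Thus the
relations of `ℋ`, pulled back to `𝐁₁^* ⊗ 𝐀₁`, contain `Θ(J^⊥ ⊗ I)`. The quantum space with the ideal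
generated by these relations is initial, provided that its own cocycle is admissible.

Identification. The contragredient carries annihilators to annihilators, so `Θ(J^⊥ ⊗ I) = (θ_ℬ J)^⊥
⊗ θ_𝒜 I`, which are the generating relations of the `▷` of the twisted spaces. Although `θ` is not
multiplicative, 2nd admissibility makes it carry each slot `V^{⊗i} ⊗ I_m ⊗ V^{⊗j}` to the slot of
`θ(I_m)` (`SecondAdmissible.mapsSlots`). Annihilators and shuffles respect slots, so `Θ` has the
same property for the relations of `ℬ ▷ 𝒜` (`mapsSlots_triRel`). An ideal is the sum of the slots of
its generators; hence `Θ` carries the ideal of `ℬ ▷ 𝒜` onto that of the twisted `▷`. This yields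
both the equality of the two descriptions and the admissibility statements.

The formulas with `𝒦` follow because `𝒦` has no relations: twisting does not change it, and `𝒦 ▷ 𝒜 ≅
𝒜`. Functoriality of `▷` and uniqueness of initial objects give the rest. -/

theorem tens_le {P : Submodule k M} {Q : Submodule k N} {S : Submodule k (M ⊗[k] N)} :
    tens P Q ≤ S ↔ ∀ x ∈ P, ∀ y ∈ Q, x ⊗ₜ y ∈ S :=
  Submodule.map₂_le

theorem tmul_mem_tens {P : Submodule k M} {Q : Submodule k N} {x : M} {y : N} (hx : x ∈ P)
    (hy : y ∈ Q) : x ⊗ₜ y ∈ tens P Q :=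
  Submodule.apply_mem_map₂ _ hx hy

theorem tens_top_top : tens (⊤ : Submodule k M) (⊤ : Submodule k N) = ⊤ :=
  TensorProduct.map₂_mk_top_top_eq_top k M N

theorem tens_map {M' N' : Type u} [AddCommGroup M'] [Module k M'] [AddCommGroup N'] [Module k N']
    (f : M →ₗ[k] M') (g : N →ₗ[k] N') (P : Submodule k M) (Q : Submodule k N) :
    (tens P Q).map (TensorProduct.map f g) = tens (P.map f) (Q.map g) := by
  rw [tens, tens, Submodule.map₂_map_map, Submodule.map_map₂]
  rfl

/-- The product `P · Q` of subspaces of tensor powers. -/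
def mulS {r s : ℕ} (P : Submodule k (⨂[k]^r V)) (Q : Submodule k (⨂[k]^s V)) :
    Submodule k (⨂[k]^(r + s) V) :=
  (tens P Q).map (mu r s).toLinearMap

theorem mu_mem_mulS {r s : ℕ} {P : Submodule k (⨂[k]^r V)} {Q : Submodule k (⨂[k]^s V)}
    {x : ⨂[k]^r V} {y : ⨂[k]^s V} (hx : x ∈ P) (hy : y ∈ Q) : mu r s (x ⊗ₜ y) ∈ mulS P Q :=
  Submodule.mem_map_of_mem (tmul_mem_tens hx hy)

theorem mulS_le {r s : ℕ} {P : Submodule k (⨂[k]^r V)} {Q : Submodule k (⨂[k]^s V)}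
    {S : Submodule k (⨂[k]^(r + s) V)} :
    mulS P Q ≤ S ↔ ∀ x ∈ P, ∀ y ∈ Q, mu r s (x ⊗ₜ y) ∈ S := by
  rw [mulS, Submodule.map_le_iff_le_comap, tens_le]
  rfl

theorem mulS_mono {r s : ℕ} {P P' : Submodule k (⨂[k]^r V)} {Q Q' : Submodule k (⨂[k]^s V)}
    (hP : P ≤ P') (hQ : Q ≤ Q') : mulS P Q ≤ mulS P' Q' :=
  mulS_le.2 fun _ hx _ hy => mu_mem_mulS (hP hx) (hQ hy)

theorem mulS_top_top (r s : ℕ) :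
    mulS (⊤ : Submodule k (⨂[k]^r V)) (⊤ : Submodule k (⨂[k]^s V)) = ⊤ := by
  rw [mulS, tens_top_top, Submodule.map_top, LinearEquiv.range]

theorem mulS_iSup_left {ι : Sort*} {r s : ℕ} (P : ι → Submodule k (⨂[k]^r V))
    (Q : Submodule k (⨂[k]^s V)) : mulS (⨆ i, P i) Q = ⨆ i, mulS (P i) Q := by
  simp only [mulS, tens, Submodule.map₂_iSup_left, Submodule.map_iSup]

theorem mulS_iSup_right {ι : Sort*} {r s : ℕ} (P : Submodule k (⨂[k]^r V))
    (Q : ι → Submodule k (⨂[k]^s V)) : mulS P (⨆ i, Q i) = ⨆ i, mulS P (Q i) := by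
  simp only [mulS, tens, Submodule.map₂_iSup_right, Submodule.map_iSup]

/-- Transport of a subspace along an equality of degrees. -/
def castS {m n : ℕ} (h : m = n) (P : Submodule k (⨂[k]^m V)) : Submodule k (⨂[k]^n V) :=
  P.map (TensorPower.cast k V h).toLinearMap

theorem castS_rfl {n : ℕ} (P : Submodule k (⨂[k]^n V)) : castS rfl P = P := by
  rw [castS, TensorPower.cast_refl]
  exact Submodule.map_id P

theorem castS_castS {l m n : ℕ} (h : l = m) (h' : m = n) (P : Submodule k (⨂[k]^l V)) :
    castS h' (castS h P) = castS (h.trans h') P := by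
  subst h h'
  rw [castS_rfl]

theorem mulS_castS_left {l m s : ℕ} (h : l = m) (P : Submodule k (⨂[k]^l V))
    (Q : Submodule k (⨂[k]^s V)) :
    mulS (castS h P) Q = castS (congrArg (· + s) h) (mulS P Q) := by
  subst h
  rw [castS_rfl, castS_rfl]

theorem castS_map {m n : ℕ} (h : m = n) (θ : Cochain1 k V) (P : Submodule k (⨂[k]^m V)) :
    (castS h P).map (θ n).toLinearMap = castS h (P.map (θ m).toLinearMap) := by
  subst h
  rw [castS_rfl, castS_rfl]

theorem mulS_assoc {r s t : ℕ} (P : Submodule k (⨂[k]^r V)) (Q : Submodule k (⨂[k]^s V))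
    (S : Submodule k (⨂[k]^t V)) :
    castS (add_assoc r s t) (mulS (mulS P Q) S) = mulS P (mulS Q S) := by
  apply le_antisymm
  · rw [castS, Submodule.map_le_iff_le_comap, mulS_le]
    intro x hx z hz
    suffices mulS P Q ≤ (mulS P (mulS Q S)).comap ((TensorPower.cast k V
        (add_assoc r s t)).toLinearMap ∘ₗ (mu (r + s) t).toLinearMap ∘ₗ
          (TensorProduct.mk k _ _).flip z) from this hx
    rw [mulS_le]
    intro x hx y hy
    rw [Submodule.mem_comap]
    change TensorPower.cast k V (add_assoc r s t) (mu (r + s) t (mu r s (x ⊗ₜ y) ⊗ₜ z)) ∈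
      mulS P (mulS Q S)
    rw [mu_assoc]
    exact mu_mem_mulS hx (mu_mem_mulS hy hz)
  · rw [mulS_le]
    intro x hx y hy
    suffices mulS Q S ≤ (castS (add_assoc r s t) (mulS (mulS P Q) S)).comap
        ((mu r (s + t)).toLinearMap ∘ₗ TensorProduct.mk k _ _ x) from this hy
    rw [mulS_le]
    intro y hy z hz
    rw [Submodule.mem_comap]
    change mu r (s + t) (x ⊗ₜ mu s t (y ⊗ₜ z)) ∈ castS _ (mulS (mulS P Q) S)
    rw [← mu_assoc]
    exact Submodule.mem_map_of_mem (mu_mem_mulS (mu_mem_mulS hx hy) hz)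

/-- The subspace `V^{⊗i} ⊗ R ⊗ V^{⊗j}`. -/
def slotS {m : ℕ} (R : Submodule k (⨂[k]^m V)) (i j : ℕ) : Submodule k (⨂[k]^(i + m + j) V) :=
  mulS (mulS (⊤ : Submodule k (⨂[k]^i V)) R) (⊤ : Submodule k (⨂[k]^j V))

/-- Multiplying a slot by a full tensor power only lengthens one of its free ends. Slots are
therefore closed under the operations that define an ideal. -/
theorem slotS_mulS_top {m : ℕ} (R : Submodule k (⨂[k]^m V)) (i j s : ℕ) :
    castS (add_assoc (i + m) j s) (mulS (slotS R i j) (⊤ : Submodule k (⨂[k]^s V))) =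
      slotS R i (j + s) := by
  rw [slotS, mulS_assoc, mulS_top_top, slotS]

theorem top_mulS_slotS {m : ℕ} (R : Submodule k (⨂[k]^m V)) (i j s : ℕ) :
    mulS (⊤ : Submodule k (⨂[k]^s V)) (slotS R i j) =
      castS (by omega) (slotS R (s + i) j) := by
  rw [slotS, slotS, ← mulS_assoc, ← mulS_assoc, mulS_top_top, mulS_castS_left, castS_castS]

/-- An explicit form of the ideal generated by `R`: the sums of the `V^{⊗i} ⊗ R_m ⊗ V^{⊗j}`. -/
def genSum (R : ∀ n : ℕ, Submodule k (⨂[k]^n V)) (n : ℕ) : Submodule k (⨂[k]^n V) :=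
  ⨆ (i : ℕ) (m : ℕ) (j : ℕ) (h : i + m + j = n), castS h (slotS (R m) i j)

theorem slotS_le_genSum (R : ∀ n : ℕ, Submodule k (⨂[k]^n V)) {n : ℕ} (i m j : ℕ)
    (h : i + m + j = n) : castS h (slotS (R m) i j) ≤ genSum R n :=
  le_iSup_of_le i (le_iSup_of_le m (le_iSup_of_le j (le_iSup_of_le h le_rfl)))

theorem mulS_genSum_top_le (R : ∀ n : ℕ, Submodule k (⨂[k]^n V)) (r s : ℕ) :
    mulS (genSum R r) (⊤ : Submodule k (⨂[k]^s V)) ≤ genSum R (r + s) := by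
  simp only [genSum, mulS_iSup_left, iSup_le_iff]
  rintro i m j rfl
  rw [castS_rfl]
  refine le_trans (le_of_eq ?_) (slotS_le_genSum R i m (j + s) (by omega))
  rw [← slotS_mulS_top, castS_castS, castS_rfl]

theorem top_mulS_genSum_le (R : ∀ n : ℕ, Submodule k (⨂[k]^n V)) (r s : ℕ) :
    mulS (⊤ : Submodule k (⨂[k]^r V)) (genSum R s) ≤ genSum R (r + s) := by
  simp only [genSum, mulS_iSup_right, iSup_le_iff]
  rintro i m j rfl
  rw [castS_rfl, top_mulS_slotS]
  exact slotS_le_genSum R (r + i) m j _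

/-- `genSum` as a graded ideal. -/
def GIdeal.ofGenSum (R : ∀ n : ℕ, Submodule k (⨂[k]^n V)) : GIdeal k V where
  deg := genSum R
  mul_left r s _ _ hy := top_mulS_genSum_le R r s (mu_mem_mulS trivial hy)
  mul_right r s _ _ hx := mulS_genSum_top_le R r s (mu_mem_mulS hx trivial)

theorem le_genSum (R : ∀ n : ℕ, Submodule k (⨂[k]^n V)) (n : ℕ) : R n ≤ genSum R n := by
  intro x hx
  -- The slot with both ends empty is `R n` itself, up to multiplication by the units in degree
  -- zero.
  have h := slotS_le_genSum R 0 n 0 (show 0 + n + 0 = n by omega)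
    (Submodule.mem_map_of_mem (mu_mem_mulS (mu_mem_mulS (P := ⊤) (x := tone k V) trivial hx)
      (Q := ⊤) (y := tone k V) trivial))
  rw [mu_tone, tone_mu] at h
  simpa [TensorPower.cast_cast] using h

theorem GIdeal.slotS_le (J : GIdeal k V) (i m j : ℕ) : slotS (J.deg m) i j ≤ J.deg (i + m + j) :=
  mulS_le.2 fun _ hx _ _ => J.mul_right _ _ _ _
    ((mulS_le.2 fun _ _ _ hy => J.mul_left _ _ _ _ hy : mulS _ _ ≤ J.deg (i + m)) hx)

theorem slotS_mono {m : ℕ} {R R' : Submodule k (⨂[k]^m V)} (h : R ≤ R') (i j : ℕ) :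
    slotS R i j ≤ slotS R' i j :=
  mulS_mono (mulS_mono le_rfl h) le_rfl

theorem GIdeal.le_gen (R : ∀ n : ℕ, Submodule k (⨂[k]^n V)) (n : ℕ) : R n ≤ (GIdeal.gen R).deg n :=
  le_iInf₂ fun _ hJ => hJ n

theorem GIdeal.gen_le {R : ∀ n : ℕ, Submodule k (⨂[k]^n V)} {J : GIdeal k V}
    (h : ∀ n, R n ≤ J.deg n) (n : ℕ) : (GIdeal.gen R).deg n ≤ J.deg n :=
  iInf₂_le J h

/-- The sums of slots form an ideal containing `R`, and any ideal containing `R` contains every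
slot. This replaces the definition by intersection with one that a linear map can be applied to,
term by term. -/
theorem GIdeal.gen_deg (R : ∀ n : ℕ, Submodule k (⨂[k]^n V)) (n : ℕ) :
    (GIdeal.gen R).deg n = genSum R n := by
  apply le_antisymm
  · exact GIdeal.gen_le (J := GIdeal.ofGenSum R) (le_genSum R) n
  · simp only [genSum, iSup_le_iff]
    rintro i m j rfl
    rw [castS_rfl]
    exact (slotS_mono (GIdeal.le_gen R m) i j).trans ((GIdeal.gen R).slotS_le i m j)

/-! ### Cochains that respect slots, and generated ideals. -/

section Map

variable {R R' : ∀ n : ℕ, Submodule k (⨂[k]^n V)} {θ : Cochain1 k V}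

theorem map_symm_of_map {m : ℕ} {e : (⨂[k]^m V) ≃ₗ[k] ⨂[k]^m V} {P Q : Submodule k (⨂[k]^m V)}
    (h : P.map e.toLinearMap = Q) : Q.map e.symm.toLinearMap = P := by
  rw [← h, ← Submodule.map_comp]
  simp

/-- A 1-cochain carries the slots of `R` to the slots of `R'`. -/
def MapsSlots (θ : Cochain1 k V) (R R' : ∀ n : ℕ, Submodule k (⨂[k]^n V)) : Prop :=
  ∀ i m j : ℕ, (slotS (R m) i j).map (θ (i + m + j)).toLinearMap = slotS (R' m) i j

theorem MapsSlots.symm (h : MapsSlots θ R R') : MapsSlots (fun n => (θ n).symm) R' R :=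
  fun i m j => map_symm_of_map (h i m j)

/-- The image of a sum is the sum of the images, so no multiplicativity of `θ` is needed beyond its
effect on slots. -/
theorem MapsSlots.gen (h : MapsSlots θ R R') (n : ℕ) :
    ((GIdeal.gen R).deg n).map (θ n).toLinearMap = (GIdeal.gen R').deg n := by
  simp only [GIdeal.gen_deg, genSum, Submodule.map_iSup, castS_map, h _ _ _]

/-- Knowing the image of the ideal is not enough here, since `θ` need not be multiplicative. The
product is instead decomposed into longer slots, on which `θ` is known. -/
theorem MapsSlots.gen_mul_top (h : MapsSlots θ R R') (r s : ℕ) :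
    (mulS ((GIdeal.gen R).deg r) (⊤ : Submodule k (⨂[k]^s V))).map (θ (r + s)).toLinearMap =
      mulS ((GIdeal.gen R').deg r) ⊤ := by
  simp only [GIdeal.gen_deg, genSum, Submodule.map_iSup, mulS_iSup_left]
  refine iSup_congr fun i => iSup_congr fun m => iSup_congr fun j => iSup_congr ?_
  rintro rfl
  have key : ∀ R : ∀ n : ℕ, Submodule k (⨂[k]^n V),
      mulS (slotS (R m) i j) (⊤ : Submodule k (⨂[k]^s V)) =
        castS (add_assoc _ _ _).symm (slotS (R m) i (j + s)) := fun R => by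
    rw [← slotS_mulS_top, castS_castS, castS_rfl]
  rw [castS_rfl, castS_rfl, key, key, castS_map, h]

theorem MapsSlots.gen_top_mul (h : MapsSlots θ R R') (r s : ℕ) :
    (mulS (⊤ : Submodule k (⨂[k]^r V)) ((GIdeal.gen R).deg s)).map (θ (r + s)).toLinearMap =
      mulS ⊤ ((GIdeal.gen R').deg s) := by
  simp only [GIdeal.gen_deg, genSum, Submodule.map_iSup, mulS_iSup_right]
  refine iSup_congr fun i => iSup_congr fun m => iSup_congr fun j => iSup_congr ?_
  rintro rfl
  rw [castS_rfl, castS_rfl, top_mulS_slotS, top_mulS_slotS, castS_map, h]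

end Map

/-! ### Admissibility of a coboundary in terms of its primitive. -/

/-- Up to `mu`, `∂θ` first moves `P ⊗ Q` back to `P' ⊗ Q'` by `(θ_r ⊗ θ_s)⁻¹`, and then sends the
product `P' · Q'` to `P · Q` by `θ_{r+s}`. -/
theorem coboundary_map_tens (θ : Cochain1 k V) (r s : ℕ) (P P' : Submodule k (⨂[k]^r V))
    (Q Q' : Submodule k (⨂[k]^s V)) (hP : P'.map (θ r).toLinearMap = P)
    (hQ : Q'.map (θ s).toLinearMap = Q)
    (h : (mulS P' Q').map (θ (r + s)).toLinearMap = mulS P Q) :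
    (tens P Q).map (coboundary θ r s).toLinearMap = tens P Q := by
  have hmu : Function.Injective (Submodule.map (mu (k := k) (V := V) r s).toLinearMap) :=
    Submodule.map_injective_of_injective (mu r s).injective
  apply hmu
  change _ = mulS P Q
  rw [← h, ← hP, ← hQ, ← tens_map, mulS, ← Submodule.map_comp, ← Submodule.map_comp,
    ← Submodule.map_comp]
  congr 1
  apply TensorProduct.ext'
  intro x y
  have := mu_coboundary θ r s (θ r x ⊗ₜ θ s y)
  rw [TensorProduct.congr_symm_tmul, LinearEquiv.symm_apply_apply,
    LinearEquiv.symm_apply_apply] at this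
  exact this

theorem CA.rel₂_eq (A : CA k) (r s : ℕ) :
    A.rel₂ r s = tens ⊤ (A.I.deg s) ⊔ tens (A.I.deg r) ⊤ := by
  rw [rel₂, TensorProduct.map_ker (LinearMap.exact_subtype_mkQ (A.I.deg r))
    (Submodule.mkQ_surjective _) (LinearMap.exact_subtype_mkQ (A.I.deg s))
    (Submodule.mkQ_surjective _), LinearMap.lTensor, LinearMap.rTensor,
    TensorProduct.range_map, TensorProduct.range_map]
  simp

/-- The kernel `rel₂` is the sum of `𝐀₁^{⊗r} ⊗ Iₛ` and `Iᵣ ⊗ 𝐀₁^{⊗s}`, and `∂θ` preserves each of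
them. The auxiliary ideal `I'` is the one that `θ` carries to `I`. -/
theorem admissible_coboundary (A : CA k) (I' : GIdeal k A.V) (θ : Cochain1 k A.V)
    (h : ∀ n, (I'.deg n).map (θ n).toLinearMap = A.I.deg n)
    (hl : ∀ r s, (mulS (⊤ : Submodule k (⨂[k]^r A.V)) (I'.deg s)).map (θ (r + s)).toLinearMap =
      mulS ⊤ (A.I.deg s))
    (hr : ∀ r s, (mulS (I'.deg r) (⊤ : Submodule k (⨂[k]^s A.V))).map (θ (r + s)).toLinearMap =
      mulS (A.I.deg r) ⊤) : A.Admissible (coboundary θ) := by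
  intro r s
  have htop : ∀ n, (⊤ : Submodule k (⨂[k]^n A.V)).map (θ n).toLinearMap = ⊤ := fun n => by
    rw [Submodule.map_top, LinearEquiv.range]
  rw [CA.rel₂_eq, Submodule.map_sup,
    coboundary_map_tens θ r s _ _ _ _ (htop r) (h s) (hl r s),
    coboundary_map_tens θ r s _ _ _ _ (h r) (htop s) (hr r s)]

end Products

/-! ### Primitives of cocycles -/

section Primitives

variable {k : Type u} [Field k] {V W : Type u} [AddCommGroup V] [Module k V]
  [AddCommGroup W] [Module k W]

/-- Uniqueness of the normalized primitive: `θ 1 = id` turns `∂θ = ψ` in degrees `(n, 1)` into the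
recursion that defines `prim`. The primitives of the inverse, the contragredient and `𝔧` are then
read off from the corresponding coboundary formulas. -/
theorem prim_eq_of_coboundary (ψ : Cochain2 k V) (θ : Cochain1 k V)
    (h0 : θ 0 = LinearEquiv.refl k _) (h1 : θ 1 = LinearEquiv.refl k _) (h : coboundary θ = ψ) :
    prim ψ = θ := by
  funext n
  induction n with
  | zero => exact h0.symm
  | succ n ih =>
    ext1 x
    obtain ⟨u, rfl⟩ := (mu (k := k) (V := V) n 1).surjective x
    induction u using TensorProduct.induction_on with
    | zero => simp
    | add u v hu hv => simp only [map_add, hu, hv]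
    | tmul x v =>
      rw [prim_succ, ih, ← h, mu_coboundary, TensorProduct.congr_symm_tmul,
        LinearEquiv.symm_apply_apply, h1]
      rfl

theorem prim_zero (ψ : Cochain2 k V) : prim ψ 0 = LinearEquiv.refl k _ := rfl

theorem prim_one' (ψ : Z2 k V) : prim ψ.toFun 1 = LinearEquiv.refl k _ :=
  LinearEquiv.ext (prim_one ψ)

theorem prim_inv (ψ : Z2 k V) : prim ψ.inv.toFun = fun n => (prim ψ.toFun n).symm :=
  prim_eq_of_coboundary _ _ rfl (by rw [prim_one']; rfl) rfl

theorem Cochain1.dual_eq_refl [FiniteDimensional k V] {θ : Cochain1 k V} {n : ℕ}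
    (h : θ n = LinearEquiv.refl k _) : θ.dual n = LinearEquiv.refl k _ := by
  ext1 x
  simp only [Cochain1.dual, h, LinearEquiv.trans_apply, LinearEquiv.refl_symm,
      LinearEquiv.dualMap_refl, LinearEquiv.refl_apply, LinearEquiv.symm_apply_apply]

theorem Cochain1.j_eq_refl {θ : Cochain1 k W} {χ : Cochain1 k V} {n : ℕ}
    (h : θ n = LinearEquiv.refl k _) (h' : χ n = LinearEquiv.refl k _) :
    Cochain1.j θ χ n = LinearEquiv.refl k _ := by
  ext1 x
  simp only [Cochain1.j, h, h', LinearEquiv.trans_apply, TensorProduct.congr_refl_refl,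
      LinearEquiv.refl_apply, LinearEquiv.symm_apply_apply]

theorem prim_dual [FiniteDimensional k V] (ψ : Z2 k V) :
    prim ψ.dual.toFun = (prim ψ.toFun).dual :=
  prim_eq_of_coboundary _ _ (Cochain1.dual_eq_refl (prim_zero _))
    (Cochain1.dual_eq_refl (prim_one' ψ))
    (by rw [← coboundary_dual, coboundary_prim]; rfl)

theorem prim_j (φ : Z2 k W) (ψ : Z2 k V) :
    prim (φ.j ψ).toFun = Cochain1.j (prim φ.toFun) (prim ψ.toFun) :=
  prim_eq_of_coboundary _ _ (Cochain1.j_eq_refl (prim_zero _) (prim_zero _))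
    (Cochain1.j_eq_refl (prim_one' φ) (prim_one' ψ))
    (by rw [← coboundary_j, coboundary_prim, coboundary_prim]; rfl)

theorem prim_one_cochain : prim (Z2.one k V).toFun = fun _ => LinearEquiv.refl k _ := by
  refine prim_eq_of_coboundary _ _ rfl rfl ?_
  funext r s
  ext1 u
  apply (mu (k := k) (V := V) r s).injective
  rw [mu_coboundary, TensorProduct.congr_refl_refl]
  rfl

end Primitives

/-! ### Twisting the relations -/

section TwistedRelations

variable {k : Type u} [Field k] {V W M N : Type u} [AddCommGroup V] [Module k V]
  [AddCommGroup W] [Module k W] [AddCommGroup M] [Module k M] [AddCommGroup N] [Module k N]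

/-- Up to `mu`, `∂(θ⁻¹)` is `θ_{r+s}⁻¹ (θ_r ⊗ θ_s)`, so it measures the failure of `θ` to be
multiplicative. On a subspace `P ⊗ Q` that it preserves, `θ` is multiplicative as far as subspaces
are concerned. -/
theorem mulS_map_of_coboundary (θ : Cochain1 k V) {r s : ℕ} {P : Submodule k (⨂[k]^r V)}
    {Q : Submodule k (⨂[k]^s V)}
    (h : (tens P Q).map (coboundary (fun n => (θ n).symm) r s).toLinearMap = tens P Q) :
    (mulS P Q).map (θ (r + s)).toLinearMap =
      mulS (P.map (θ r).toLinearMap) (Q.map (θ s).toLinearMap) := by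
  rw [mulS, mulS, ← tens_map]
  conv_lhs => rw [← h]
  rw [← Submodule.map_comp, ← Submodule.map_comp, ← Submodule.map_comp]
  congr 1
  apply TensorProduct.ext'
  intro x y
  simp only [LinearMap.comp_apply, LinearEquiv.coe_coe, mu_coboundary,
    TensorProduct.congr_symm_tmul, LinearEquiv.symm_symm, LinearEquiv.apply_symm_apply,
    TensorProduct.map_tmul]

theorem mulS_top_zero {r : ℕ} (P : Submodule k (⨂[k]^r V)) :
    mulS P (⊤ : Submodule k (⨂[k]^0 V)) = castS (add_zero r).symm P := by
  apply le_antisymm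
  · rw [mulS_le]
    intro x hx y _
    obtain ⟨c, rfl⟩ := exists_smul_tone y
    rw [TensorProduct.tmul_smul, map_smul, mu_tone]
    exact Submodule.smul_mem _ _ (Submodule.mem_map_of_mem hx)
  · rintro _ ⟨x, hx, rfl⟩
    have := mu_mem_mulS hx (Q := ⊤) (y := tone k V) trivial
    rwa [mu_tone] at this

theorem top_mulS_zero {r : ℕ} (P : Submodule k (⨂[k]^r V)) :
    mulS (⊤ : Submodule k (⨂[k]^0 V)) P = castS (zero_add r).symm P := by
  apply le_antisymm
  · rw [mulS_le]
    intro y _ x hx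
    obtain ⟨c, rfl⟩ := exists_smul_tone y
    rw [← TensorProduct.smul_tmul', map_smul, tone_mu]
    exact Submodule.smul_mem _ _ (Submodule.mem_map_of_mem hx)
  · rintro _ ⟨x, hx, rfl⟩
    have := mu_mem_mulS (P := ⊤) (x := tone k V) trivial hx
    rwa [tone_mu] at this

/-- The primitive of `𝔦ψ` is `θ⁻¹`, and the kernel of the projection composed with `θ⁻¹` is the
image of the relations under `θ`. -/
theorem CA.twist_inv_deg (A : CA k) (ψ : Z2 k A.V) (h : A.Admissible ψ.inv.toFun) (n : ℕ) :
    (A.twist ψ.inv h).I.deg n = (A.I.deg n).map (prim ψ.toFun n).toLinearMap := by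
  change LinearMap.ker (A.proj n ∘ₗ (prim ψ.inv.toFun n).toLinearMap) = _
  rw [LinearMap.ker_comp, Submodule.ker_mkQ, prim_inv]
  exact (Submodule.map_equiv_eq_comap_symm _ _).symm

/-- The only use of 2nd admissibility beyond admissibility: multiplicativity of `θ` on subspaces is
applied twice, to `(𝐀₁^{⊗i} ⊗ I_m) ⊗ 𝐀₁^{⊗j}` and then to `𝐀₁^{⊗i} ⊗ I_m`. Slots with `j = 0`
suffice. -/
theorem CA.SecondAdmissible.mapsSlots {A : CA k} {ψ : Z2 k A.V}
    (h : A.SecondAdmissible ψ.inv.toFun) :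
    MapsSlots (prim ψ.toFun) A.I.deg (A.twist ψ.inv h.1).I.deg := by
  have htop : ∀ n, (⊤ : Submodule k (⨂[k]^n A.V)).map (prim ψ.toFun n).toLinearMap = ⊤ :=
    fun n => by rw [Submodule.map_top, LinearEquiv.range]
  have h2 := h.2
  intro i m j
  -- The slot with empty ends lives in degree `0 + m + 0`, which is only propositionally equal to
  -- `m`; the invariance is moved across that equality.
  have hcast : ∀ n (e : m = n),
      (tens (⊤ : Submodule k (⨂[k]^i A.V)) (castS e (A.I.deg m))).map
        (ψ.inv.toFun i n).toLinearMap = tens ⊤ (castS e (A.I.deg m)) →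
      (tens (⊤ : Submodule k (⨂[k]^i A.V)) (A.I.deg m)).map
        (ψ.inv.toFun i m).toLinearMap = tens ⊤ (A.I.deg m) := by
    rintro _ rfl
    rw [castS_rfl]
    exact id
  have hright := hcast (0 + m + 0) (by omega) (by
    have := (h2 0 m 0 i).2
    have e : A.slot 0 m 0 = castS (by omega) (A.I.deg m) := by
      change mulS (mulS ⊤ (A.I.deg m)) ⊤ = _
      rw [mulS_top_zero, top_mulS_zero, castS_castS]
    rwa [e] at this)
  have hleft : (tens (mulS (⊤ : Submodule k (⨂[k]^i A.V)) (A.I.deg m))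
      (⊤ : Submodule k (⨂[k]^j A.V))).map (ψ.inv.toFun (i + m) j).toLinearMap =
        tens (mulS ⊤ (A.I.deg m)) ⊤ := by
    have := (h2 i m 0 j).1
    have e : A.slot i m 0 = mulS (⊤ : Submodule k (⨂[k]^i A.V)) (A.I.deg m) := by
      change mulS (mulS ⊤ (A.I.deg m)) ⊤ = _
      rw [mulS_top_zero]
      exact castS_rfl _
    rwa [e] at this
  change (mulS (mulS ⊤ (A.I.deg m)) ⊤).map _ = mulS (mulS ⊤ _) ⊤
  rw [mulS_map_of_coboundary _ hleft, mulS_map_of_coboundary _ hright, htop, htop,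
    A.twist_inv_deg]

/-! ### Annihilators -/

instance tensorPower_finite [FiniteDimensional k V] (n : ℕ) : FiniteDimensional k (⨂[k]^n V) :=
  inferInstanceAs (Module.Finite k (PiTensorProduct k fun _ : Fin n => V))

/-- The annihilator of `P ⊆ V^{⊗n}` in `(V^*)^{⊗n}`. -/
def perpS [FiniteDimensional k V] {n : ℕ} (P : Submodule k (⨂[k]^n V)) :
    Submodule k (⨂[k]^n (Module.Dual k V)) :=
  P.dualAnnihilator.comap (dualPw n).toLinearMap

theorem mem_perpS [FiniteDimensional k V] {n : ℕ} {P : Submodule k (⨂[k]^n V)}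
    {f : ⨂[k]^n (Module.Dual k V)} : f ∈ perpS P ↔ ∀ x ∈ P, dualPw n f x = 0 :=
  Submodule.mem_dualAnnihilator _

/-- Dimensions decide the annihilators of products below, where only one inclusion is obvious. -/
theorem finrank_perpS [FiniteDimensional k V] {n : ℕ} (P : Submodule k (⨂[k]^n V)) :
    Module.finrank k P + Module.finrank k (perpS P) = Module.finrank k (⨂[k]^n V) := by
  rw [← Subspace.finrank_add_finrank_dualAnnihilator_eq P,
    ← LinearEquiv.finrank_map_eq (dualPw (k := k) (V := V) n) (perpS P), perpS,
    Submodule.map_comap_eq_of_surjective (dualPw n).surjective]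

theorem map_perpS [FiniteDimensional k V] {n : ℕ} (P : Submodule k (⨂[k]^n V)) :
    (perpS P).map (dualPw n).toLinearMap = P.dualAnnihilator :=
  Submodule.map_comap_eq_of_surjective (dualPw n).surjective _

theorem perpS_eq_of_le_of_finrank [FiniteDimensional k V] {n : ℕ} {P : Submodule k (⨂[k]^n V)}
    {Q : Submodule k (⨂[k]^n (Module.Dual k V))} (h : Q ≤ perpS P)
    (hQ : Module.finrank k P + Module.finrank k Q = Module.finrank k (⨂[k]^n V)) :
    perpS P = Q := by
  apply Submodule.map_injective_of_injective (f := (dualPw n).toLinearMap) (dualPw n).injective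
  symm
  apply Submodule.eq_of_le_of_finrank_eq
  · exact Submodule.map_mono h
  · rw [map_perpS, LinearEquiv.finrank_map_eq]
    have := Subspace.finrank_add_finrank_dualAnnihilator_eq P
    omega

theorem finrank_dual_tensorPower [FiniteDimensional k V] (n : ℕ) :
    Module.finrank k (⨂[k]^n (Module.Dual k V)) = Module.finrank k (⨂[k]^n V) := by
  rw [(dualPw (k := k) (V := V) n).finrank_eq, Subspace.dual_finrank_eq]

theorem finrank_tens (P : Submodule k M) (Q : Submodule k N) :
    Module.finrank k (tens P Q) = Module.finrank k P * Module.finrank k Q := by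
  rw [tens, ← TensorProduct.range_mapIncl, LinearMap.finrank_range_of_inj,
    Module.finrank_tensorProduct]
  exact TensorProduct.map_injective_of_flat_flat _ _ P.injective_subtype Q.injective_subtype

theorem finrank_mulS {r s : ℕ} (P : Submodule k (⨂[k]^r V)) (Q : Submodule k (⨂[k]^s V)) :
    Module.finrank k (mulS P Q) = Module.finrank k P * Module.finrank k Q := by
  rw [mulS, LinearEquiv.finrank_map_eq, finrank_tens]

theorem finrank_tensorPower_add (r s : ℕ) : Module.finrank k (⨂[k]^(r + s) V) =
    Module.finrank k (⨂[k]^r V) * Module.finrank k (⨂[k]^s V) := by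
  rw [← (mu (k := k) (V := V) r s).finrank_eq, Module.finrank_tensorProduct]

/-- Functionals in `P^⊥ · ⊤` kill `P · ⊤` because the pairing is multiplicative; the dimensions of
both sides agree. -/
theorem perpS_mulS_top [FiniteDimensional k V] {r : ℕ} (s : ℕ) (P : Submodule k (⨂[k]^r V)) :
    perpS (mulS P (⊤ : Submodule k (⨂[k]^s V))) = mulS (perpS P) ⊤ := by
  apply perpS_eq_of_le_of_finrank
  · rw [mulS_le]
    intro f hf g _
    rw [mem_perpS]
    suffices mulS P (⊤ : Submodule k (⨂[k]^s V)) ≤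
      LinearMap.ker (dualPw (r + s) (mu r s (f ⊗ₜ g))) from fun x hx => this hx
    rw [mulS_le]
    intro x hx y _
    rw [LinearMap.mem_ker, dualPw_mu, dualPw₂_tmul, mem_perpS.1 hf x hx, zero_mul]
  · rw [finrank_mulS, finrank_mulS, finrank_tensorPower_add, ← finrank_perpS P, finrank_top,
      finrank_top, finrank_dual_tensorPower, add_mul]

theorem perpS_top_mulS [FiniteDimensional k V] {s : ℕ} (r : ℕ) (Q : Submodule k (⨂[k]^s V)) :
    perpS (mulS (⊤ : Submodule k (⨂[k]^r V)) Q) = mulS ⊤ (perpS Q) := by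
  apply perpS_eq_of_le_of_finrank
  · rw [mulS_le]
    intro f _ g hg
    rw [mem_perpS]
    suffices mulS (⊤ : Submodule k (⨂[k]^r V)) Q ≤
      LinearMap.ker (dualPw (r + s) (mu r s (f ⊗ₜ g))) from fun x hx => this hx
    rw [mulS_le]
    intro x _ y hy
    rw [LinearMap.mem_ker, dualPw_mu, dualPw₂_tmul, mem_perpS.1 hg y hy, mul_zero]
  · rw [finrank_mulS, finrank_mulS, finrank_tensorPower_add, ← finrank_perpS Q, finrank_top,
      finrank_top, finrank_dual_tensorPower, mul_add]

theorem perpS_slotS [FiniteDimensional k V] {m : ℕ} (P : Submodule k (⨂[k]^m V)) (i j : ℕ) :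
    perpS (slotS P i j) = slotS (perpS P) i j := by
  rw [slotS, perpS_mulS_top, perpS_top_mulS, slotS]

/-- The contragredient is defined so that `⟨θ^! f, θ x⟩ = ⟨f, x⟩`. -/
theorem perpS_map [FiniteDimensional k V] (θ : Cochain1 k V) {n : ℕ}
    (P : Submodule k (⨂[k]^n V)) :
    (perpS P).map (θ.dual n).toLinearMap = perpS (P.map (θ n).toLinearMap) := by
  ext f
  rw [Submodule.map_equiv_eq_comap_symm, Submodule.mem_comap, mem_perpS, mem_perpS]
  constructor
  · rintro h _ ⟨x, hx, rfl⟩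
    rw [← h x hx]
    exact (dualPw_dual_symm θ n f x).symm
  · intro h x hx
    rw [← h _ (Submodule.mem_map_of_mem hx)]
    exact dualPw_dual_symm θ n f x

/-! ### Shuffles of subspaces -/

/-- The subspace `P ⊗ Q` of `W^{⊗n} ⊗ V^{⊗n}`, transported to `(W ⊗ V)^{⊗n}`. -/
def shuffleS {n : ℕ} (P : Submodule k (⨂[k]^n W)) (Q : Submodule k (⨂[k]^n V)) :
    Submodule k (⨂[k]^n (W ⊗[k] V)) :=
  (tens P Q).comap (shuffle n).toLinearMap

theorem map_shuffleS {n : ℕ} (P : Submodule k (⨂[k]^n W)) (Q : Submodule k (⨂[k]^n V)) :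
    (shuffleS P Q).map (shuffle n).toLinearMap = tens P Q :=
  Submodule.map_comap_eq_of_surjective (shuffle n).surjective _

theorem shuffleS_top_top (n : ℕ) :
    shuffleS (⊤ : Submodule k (⨂[k]^n W)) (⊤ : Submodule k (⨂[k]^n V)) = ⊤ := by
  rw [shuffleS, tens_top_top, Submodule.comap_top]

theorem shuffleS_map (θ : Cochain1 k W) (χ : Cochain1 k V) {n : ℕ}
    (P : Submodule k (⨂[k]^n W)) (Q : Submodule k (⨂[k]^n V)) :
    (shuffleS P Q).map (Cochain1.j θ χ n).toLinearMap =
      shuffleS (P.map (θ n).toLinearMap) (Q.map (χ n).toLinearMap) := by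
  apply Submodule.map_injective_of_injective (f := (shuffle n).toLinearMap) (shuffle n).injective
  rw [map_shuffleS, ← tens_map, ← map_shuffleS, ← Submodule.map_comp, ← Submodule.map_comp]
  congr 1
  refine LinearMap.ext fun u => ?_
  simp only [LinearMap.comp_apply, LinearEquiv.coe_coe, Cochain1.j, LinearEquiv.trans_apply,
    LinearEquiv.apply_symm_apply]
  rfl

theorem tens_tens_map_comm_le {M' N' : Type u} [AddCommGroup M'] [Module k M'] [AddCommGroup N']
    [Module k N'] (P : Submodule k M) (Q : Submodule k N) (P' : Submodule k M')
    (Q' : Submodule k N') :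
    (tens (tens P Q) (tens P' Q')).map
      (TensorProduct.tensorTensorTensorComm k M N M' N').toLinearMap ≤
        tens (tens P P') (tens Q Q') := by
  rw [Submodule.map_le_iff_le_comap, tens_le]
  intro u hu v hv
  suffices tens P Q ≤ (tens (tens P P') (tens Q Q')).comap
    ((TensorProduct.tensorTensorTensorComm k M N M' N').toLinearMap ∘ₗ
      (TensorProduct.mk k _ _).flip v) from this hu
  rw [tens_le]
  intro x hx y hy
  suffices tens P' Q' ≤ (tens (tens P P') (tens Q Q')).comap
    ((TensorProduct.tensorTensorTensorComm k M N M' N').toLinearMap ∘ₗ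
      TensorProduct.mk k _ _ (x ⊗ₜ y)) from this hv
  rw [tens_le]
  intro x' hx' y' hy'
  exact tmul_mem_tens (tmul_mem_tens hx hx') (tmul_mem_tens hy hy')

/-- The exchange of the middle factors is inverse to another exchange of the same form, so the
inclusion already proved applies in both directions. -/
theorem tens_tens_map_comm {M' N' : Type u} [AddCommGroup M'] [Module k M'] [AddCommGroup N']
    [Module k N'] (P : Submodule k M) (Q : Submodule k N) (P' : Submodule k M')
    (Q' : Submodule k N') :
    (tens (tens P Q) (tens P' Q')).map
      (TensorProduct.tensorTensorTensorComm k M N M' N').toLinearMap =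
        tens (tens P P') (tens Q Q') := by
  apply (tens_tens_map_comm_le P Q P' Q').antisymm
  have := Submodule.map_mono (f := (TensorProduct.tensorTensorTensorComm k M N M' N').toLinearMap)
    (tens_tens_map_comm_le P P' Q Q')
  rw [← Submodule.map_comp] at this
  refine le_trans (le_of_eq ?_) this
  rw [← TensorProduct.tensorTensorTensorComm_symm, LinearEquiv.symm_comp]
  exact (Submodule.map_id _).symm

theorem mulS_shuffleS {r s : ℕ} (P : Submodule k (⨂[k]^r W)) (Q : Submodule k (⨂[k]^r V))
    (P' : Submodule k (⨂[k]^s W)) (Q' : Submodule k (⨂[k]^s V)) :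
    mulS (shuffleS P Q) (shuffleS P' Q') = shuffleS (mulS P P') (mulS Q Q') := by
  apply Submodule.map_injective_of_injective (f := (shuffle (r + s)).toLinearMap)
    (shuffle (r + s)).injective
  rw [map_shuffleS, mulS, mulS, mulS, ← tens_map, ← tens_tens_map_comm, ← map_shuffleS,
    ← map_shuffleS, ← tens_map, ← Submodule.map_comp, ← Submodule.map_comp, ← Submodule.map_comp]
  congr 1
  refine LinearMap.ext fun u => ?_
  simp only [LinearMap.comp_apply, LinearEquiv.coe_coe, shuffle_mu]
  rfl

theorem slotS_shuffleS {m : ℕ} (P : Submodule k (⨂[k]^m W)) (Q : Submodule k (⨂[k]^m V))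
    (i j : ℕ) : slotS (shuffleS P Q) i j = shuffleS (slotS P i j) (slotS Q i j) := by
  rw [slotS, ← shuffleS_top_top, ← shuffleS_top_top, mulS_shuffleS, mulS_shuffleS, slotS, slotS]

/-- Writes a slot of `J^⊥ ⊗ I` through slots of `J` and of `I`, the form in which 2nd admissibility
of the two factors can be used separately. -/
theorem CA.slotS_triRel (B A : CA k) (i m j : ℕ) :
    slotS (V := Module.Dual k B.V ⊗[k] A.V) (B.triRel A m) i j =
    shuffleS (perpS (slotS (B.I.deg m) i j)) (slotS (A.I.deg m) i j) := by
  rw [perpS_slotS]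
  exact slotS_shuffleS _ _ i j

/-- The 1-cochain `θ_ℬ^! ⊗ θ_𝒜` on `𝐁₁^* ⊗ 𝐀₁`. -/
abbrev CA.triCochain {B A : CA k} (β : Z2 k B.V) (α : Z2 k A.V) :
    Cochain1 k (Module.Dual k B.V ⊗[k] A.V) :=
  Cochain1.j (prim β.toFun).dual (prim α.toFun)

/-! ### Twisting `ℬ ▷ 𝒜`. -/

section Tri

variable {B A : CA k} {β : Z2 k B.V} {α : Z2 k A.V}

/-- The cochain `θ_ℬ^! ⊗ θ_𝒜` acts factorwise: on the left it follows annihilators of slots of `J`,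
on the right slots of `I`. -/
theorem CA.mapsSlots_triRel
    (hβ : B.SecondAdmissible β.inv.toFun) (hα : A.SecondAdmissible α.inv.toFun) :
    MapsSlots (triCochain β α) (B.triRel A)
    ((B.twist β.inv hβ.1).triRel (A.twist α.inv hα.1)) := by
  intro i m j
  have h1 := congrArg (Submodule.map (triCochain β α (i + m + j)).toLinearMap)
    (CA.slotS_triRel B A i m j)
  have h2 := shuffleS_map (prim β.toFun).dual (prim α.toFun)
    (perpS (slotS (B.I.deg m) i j)) (slotS (A.I.deg m) i j)
  rw [perpS_map] at h2
  have h3 := congrArg₂ (fun P Q => shuffleS (perpS P) Q) (hβ.mapsSlots i m j)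
    (hα.mapsSlots i m j)
  have h4 := CA.slotS_triRel (B.twist β.inv hβ.1) (A.twist α.inv hα.1) i m j
  exact h1.trans (h2.trans (h3.trans h4.symm))

theorem CA.admissible_gen {V : Type u} [AddCommGroup V] [Module k V] [FiniteDimensional k V]
    {R R' : ∀ n : ℕ, Submodule k (⨂[k]^n V)} {h0 h1} {θ : Cochain1 k V} {ψ : Z2 k V}
    (h : MapsSlots θ R' R) (hψ : prim ψ.toFun = θ) :
    (CA.mk V (GIdeal.gen R) h0 h1).Admissible ψ.toFun := by
  rw [← coboundary_prim, hψ]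
  exact admissible_coboundary (CA.mk V (GIdeal.gen R) h0 h1) (GIdeal.gen R') _ h.gen
    h.gen_top_mul h.gen_mul_top

theorem CA.prim_j_dual (β : Z2 k W) (α : Z2 k V) [FiniteDimensional k W] :
    prim (Z2.j β.dual α).toFun = Cochain1.j (prim β.toFun).dual (prim α.toFun) := by
  rw [prim_j, prim_dual]

theorem CA.prim_j_inv (β : Z2 k W) (α : Z2 k V) [FiniteDimensional k W] :
    prim (Z2.j β.inv.dual α.inv).toFun =
      fun n => (Cochain1.j (prim β.toFun).dual (prim α.toFun) n).symm := by
  rw [prim_j, prim_dual, prim_inv, prim_inv]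
  rfl

theorem CA.admissible_tri_inv
    (hβ : B.SecondAdmissible β.inv.toFun) (hα : A.SecondAdmissible α.inv.toFun) :
    (B.tri A).Admissible (Z2.j β.inv.dual α.inv).toFun :=
  CA.admissible_gen (CA.mapsSlots_triRel hβ hα).symm (CA.prim_j_inv β α)

/-- Needed for the universal object to belong to `Ω`: the untwisted cochain `𝔧(ψ_ℬ^!, ψ_𝒜)` has to
be admissible for the space with the twisted relations. -/
theorem CA.admissible_tri_twist
    (hβ : B.SecondAdmissible β.inv.toFun) (hα : A.SecondAdmissible α.inv.toFun) :
    ((B.twist β.inv hβ.1).tri (A.twist α.inv hα.1)).Admissible (Z2.j β.dual α).toFun :=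
  CA.admissible_gen (CA.mapsSlots_triRel hβ hα) (CA.prim_j_dual β α)

theorem CA.eq_of_deg_eq {V : Type u} [AddCommGroup V] [Module k V] [FiniteDimensional k V]
    {I I' : GIdeal k V} {h0 h1 h0' h1'} (h : ∀ n, I.deg n = I'.deg n) :
    CA.mk V I h0 h1 = CA.mk V I' h0' h1' := by
  obtain rfl : I = I' := GIdeal.ext (funext h)
  rfl

/-- Both spaces have the same generators. The ideal generated by the images of the relations equals
the image of the generated ideal, because slots go to slots. -/
theorem CA.tri_twist_eq
    (hβ : B.SecondAdmissible β.inv.toFun) (hα : A.SecondAdmissible α.inv.toFun) :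
    (B.twist β.inv hβ.1).tri (A.twist α.inv hα.1) =
    (B.tri A).twist (Z2.j β.inv.dual α.inv) (CA.admissible_tri_inv hβ hα) := by
  refine CA.eq_of_deg_eq fun n => ?_
  refine ((CA.mapsSlots_triRel hβ hα).gen n).symm.trans ?_
  refine Eq.trans ?_ (LinearMap.ker_comp (prim (Z2.j β.inv.dual α.inv).toFun n).toLinearMap
    ((B.tri A).proj n)).symm
  rw [CA.prim_j_inv]
  refine Eq.trans ?_ (congrArg _ (Submodule.ker_mkQ _).symm)
  exact Submodule.map_equiv_eq_comap_symm _ _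

end Tri

end TwistedRelations

/-! ### Contraction and coevaluation -/

section Contraction

variable {k : Type u} [Field k] {V W U M N : Type u} [AddCommGroup V] [Module k V]
  [AddCommGroup W] [Module k W] [AddCommGroup U] [Module k U] [AddCommMonoid M] [Module k M]
  [AddCommMonoid N] [Module k N]

/-- The contraction `id ⊗ f : M ⊗ U → M` with a functional `f` on `U`. -/
def contract (M : Type u) [AddCommMonoid M] [Module k M] (f : Module.Dual k U) :
    M ⊗[k] U →ₗ[k] M :=
  (TensorProduct.rid k M).toLinearMap ∘ₗ LinearMap.lTensor M f

theorem contract_tmul (f : Module.Dual k U) (m : M) (u : U) :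
    contract M f (m ⊗ₜ u) = f u • m := by
  simp [contract]

theorem contract_map (f : Module.Dual k W) (g : M →ₗ[k] N) (h : U →ₗ[k] W) (x : M ⊗[k] U) :
    contract N f (TensorProduct.map g h x) = g (contract M (f ∘ₗ h) x) := by
  induction x using TensorProduct.induction_on with
  | zero => simp
  | add x y hx hy => simp only [map_add, hx, hy]
  | tmul m u => simp only [TensorProduct.map_tmul, contract_tmul, map_smul, LinearMap.comp_apply]

/-- A tensor is recovered from its contractions with a dual basis. -/
theorem contract_ext [FiniteDimensional k U] {x y : M ⊗[k] U}
    (h : ∀ f : Module.Dual k U, contract M f x = contract M f y) : x = y := by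
  have key : ∀ x : M ⊗[k] U, x = ∑ i, contract M ((Module.finBasis k U).coord i) x ⊗ₜ
      Module.finBasis k U i := by
    intro x
    induction x using TensorProduct.induction_on with
    | zero => simp
    | add x y hx hy =>
      simp only [map_add, TensorProduct.add_tmul, Finset.sum_add_distrib]
      rw [← hx, ← hy]
    | tmul m u =>
      simp only [contract_tmul, TensorProduct.smul_tmul, ← TensorProduct.tmul_sum]
      simp only [Module.Basis.coord_apply, Module.Basis.sum_repr]
  rw [key x, key y]
  simp only [h]

/-- `a ↦ ∑ⱼ e(bʲ ⊗ a) ⊗ bⱼ` for a basis `(bⱼ)` of `U`. -/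
def coev [FiniteDimensional k U] (e : Module.Dual k U ⊗[k] V →ₗ[k] W) : V →ₗ[k] W ⊗[k] U :=
  ∑ i, (TensorProduct.mk k W U).flip (Module.finBasis k U i) ∘ₗ e ∘ₗ
    TensorProduct.mk k (Module.Dual k U) V ((Module.finBasis k U).coord i)

theorem contract_coev [FiniteDimensional k U] (e : Module.Dual k U ⊗[k] V →ₗ[k] W)
    (f : Module.Dual k U) (a : V) : contract W f (coev e a) = e (f ⊗ₜ a) := by
  have : f = ∑ i, f (Module.finBasis k U i) • (Module.finBasis k U).coord i := by
    apply (Module.finBasis k U).ext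
    intro j
    simp
  conv_rhs => rw [this, TensorProduct.sum_tmul]
  simp only [coev, LinearMap.sum_apply, LinearMap.comp_apply, LinearMap.flip_apply,
    TensorProduct.mk_apply, map_sum, contract_tmul, ← TensorProduct.smul_tmul', map_smul]

theorem contract_shuffle {M : Type u} [AddCommGroup M] [Module k M] [FiniteDimensional k U] {n : ℕ}
    (f : Fin n → Module.Dual k U)
    (x : ⨂[k]^n (M ⊗[k] U)) :
    contract _ (dualPw n (PiTensorProduct.tprod k f)) (shuffle n x) =
      PiTensorProduct.map (fun i => contract M (f i)) x := by
  have : contract _ (dualPw n (PiTensorProduct.tprod k f)) ∘ₗ (shuffle n).toLinearMap =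
      PiTensorProduct.map (fun i => contract M (f i)) := by
    apply shuffle_ext
    intro w v
    rw [LinearMap.comp_apply, LinearEquiv.coe_coe, shuffle_tprod, contract_tmul, dualPw_tprod,
      PiTensorProduct.map_tprod]
    simp only [contract_tmul]
    rw [MultilinearMap.map_smul_univ]
  exact LinearMap.congr_fun this x

/-- The bridge between `∘` and `▷`: contracting the `n`-fold coevaluation of `x` with `f` yields the
element `f ⊗ x` of `(U^* ⊗ V)^{⊗n}`, pushed forward by `e`. Multilinearity reduces it to pure
tensors, where each factor is `contract_coev`. -/
theorem contract_shuffle_coev [FiniteDimensional k U] (e : Module.Dual k U ⊗[k] V →ₗ[k] W)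
    {n : ℕ} (f : ⨂[k]^n (Module.Dual k U)) (x : ⨂[k]^n V) :
    contract (⨂[k]^n W) (dualPw n f) (shuffle n (pw (coev e) n x)) =
      pw e n ((shuffle n).symm (f ⊗ₜ x)) := by
  induction f using PiTensorProduct.induction_on with
  | smul_tprod c f =>
    have hs : ∀ (g : Module.Dual k (⨂[k]^n U)) y,
        contract (⨂[k]^n W) (c • g) y = c • contract _ g y := fun g y => by
      simp [contract]
    rw [map_smul, ← TensorProduct.smul_tmul', map_smul, map_smul, hs]
    congr 1
    rw [contract_shuffle]
    induction x using PiTensorProduct.induction_on with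
    | smul_tprod c a =>
      rw [TensorProduct.tmul_smul, map_smul, map_smul, map_smul, map_smul, pw_tprod,
        PiTensorProduct.map_tprod]
      simp only [contract_coev]
      rw [← shuffle_tprod, LinearEquiv.symm_apply_apply, pw_tprod]
    | add x y hx hy => simp only [map_add, TensorProduct.tmul_add, hx, hy]
  | add f g hf hg =>
    have hs : ∀ (f g : Module.Dual k (⨂[k]^n U)) y,
        contract (⨂[k]^n W) (f + g) y = contract _ f y + contract _ g y := fun f g y => by
      simp [contract, LinearMap.lTensor_add]
    rw [map_add, hs, hf, hg, TensorProduct.add_tmul, map_add, map_add]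

end Contraction

/-! ### Naturality of coboundaries and primitives -/

section Naturality

variable {k : Type u} [Field k] {V W : Type u} [AddCommGroup V] [Module k V]
  [AddCommGroup W] [Module k W]

/-- A primitive is an iterated application of its cocycle, so it inherits naturality by induction on
the degree. -/
theorem prim_pw {ψ : Cochain2 k V} {ψ' : Cochain2 k W} {p : V →ₗ[k] W}
    (h : ∀ r s u, ψ' r s (TensorProduct.map (pw p r) (pw p s) u) =
      TensorProduct.map (pw p r) (pw p s) (ψ r s u)) (n : ℕ) (x : ⨂[k]^n V) :
    prim ψ' n (pw p n x) = pw p n (prim ψ n x) := by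
  induction n with
  | zero => rfl
  | succ n ih =>
    have hmu : ∀ u, mu n 1 (TensorProduct.map (pw p n) (pw p 1) u) = pw p (n + 1) (mu n 1 u) := by
      intro u
      induction u using TensorProduct.induction_on with
      | zero => simp
      | add x y hx hy => simp only [map_add, hx, hy]
      | tmul x y => rw [TensorProduct.map_tmul, pw_mu]
    obtain ⟨u, rfl⟩ := (mu (k := k) (V := V) n 1).surjective x
    induction u using TensorProduct.induction_on with
    | zero => simp
    | add u v hu hv => simp only [map_add, hu, hv]
    | tmul x v =>
      rw [pw_mu, prim_succ, prim_succ, ih, ← TensorProduct.map_tmul, h, hmu]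

theorem coboundary_pw {θ : Cochain1 k V} {θ' : Cochain1 k W} {p : V →ₗ[k] W}
    (h : ∀ n x, θ' n (pw p n x) = pw p n (θ n x)) (r s : ℕ) (u : (⨂[k]^r V) ⊗[k] ⨂[k]^s V) :
    coboundary θ' r s (TensorProduct.map (pw p r) (pw p s) u) =
      TensorProduct.map (pw p r) (pw p s) (coboundary θ r s u) := by
  -- Parametrizing the argument by `θ_r ⊗ θ_s` cancels the inverse in `∂θ`.
  obtain ⟨u, rfl⟩ := (TensorProduct.congr (θ r) (θ s)).surjective u
  apply (mu (k := k) (V := W) r s).injective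
  have hmu : ∀ u, mu r s (TensorProduct.map (pw p r) (pw p s) u) = pw p (r + s) (mu r s u) := by
    intro u
    induction u using TensorProduct.induction_on with
    | zero => simp
    | add x y hx hy => simp only [map_add, hx, hy]
    | tmul x y => rw [TensorProduct.map_tmul, pw_mu]
  rw [hmu, mu_coboundary, mu_coboundary, LinearEquiv.symm_apply_apply, ← h, ← hmu]
  congr 2
  rw [LinearEquiv.symm_apply_eq]
  induction u using TensorProduct.induction_on with
  | zero => simp
  | add x y hx hy => simp only [map_add, hx, hy]
  | tmul x y => simp only [TensorProduct.congr_tmul, TensorProduct.map_tmul, h]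

/-- The action of a linear equivalence on tensor powers. -/
def pwEquiv (e : V ≃ₗ[k] W) (n : ℕ) : (⨂[k]^n V) ≃ₗ[k] ⨂[k]^n W :=
  LinearEquiv.ofLinearMap (pw e.toLinearMap n) (pw e.symm.toLinearMap n)
    (by rw [← pw_comp, LinearEquiv.comp_symm, pw_id])
    (by rw [← pw_comp, LinearEquiv.symm_comp, pw_id])

theorem pwEquiv_apply (e : V ≃ₗ[k] W) (n : ℕ) (x : ⨂[k]^n V) :
    pwEquiv e n x = pw e.toLinearMap n x := rfl

/-- Transport of a counital 2-cocycle along a linear equivalence. -/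
def Z2.transport (ψ : Z2 k V) (e : V ≃ₗ[k] W) : Z2 k W :=
  Z2.ofCochain1 (fun n => (pwEquiv e n).symm ≪≫ₗ prim ψ.toFun n ≪≫ₗ pwEquiv e n) (by
    ext1 x
    exact (pwEquiv e 0).apply_symm_apply x)

theorem Z2.transport_apply (ψ : Z2 k V) (e : V ≃ₗ[k] W) (r s : ℕ)
    (u : (⨂[k]^r V) ⊗[k] ⨂[k]^s V) :
    (ψ.transport e).toFun r s (TensorProduct.map (pw e.toLinearMap r) (pw e.toLinearMap s) u) =
      TensorProduct.map (pw e.toLinearMap r) (pw e.toLinearMap s) (ψ.toFun r s u) := by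
  have h := coboundary_pw (θ := prim ψ.toFun)
    (θ' := fun n => (pwEquiv e n).symm ≪≫ₗ prim ψ.toFun n ≪≫ₗ pwEquiv e n) (p := e.toLinearMap)
    (fun n x => by
      rw [← pwEquiv_apply, ← pwEquiv_apply]
      simp only [LinearEquiv.trans_apply, LinearEquiv.symm_apply_apply]) r s u
  rw [coboundary_prim] at h
  exact h

end Naturality

/-! ### Admissibility for isomorphic spaces and for `∘` -/

section Admissibility

variable {k : Type u} [Field k]

theorem ker_map_of_surjective {M N M' N' : Type u} [AddCommGroup M] [Module k M]
    [AddCommGroup N] [Module k N] [AddCommGroup M'] [Module k M'] [AddCommGroup N'] [Module k N']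
    {f : M →ₗ[k] M'} {g : N →ₗ[k] N'} (hf : Function.Surjective f)
    (hg : Function.Surjective g) : LinearMap.ker (TensorProduct.map f g) =
      tens ⊤ (LinearMap.ker g) ⊔ tens (LinearMap.ker f) ⊤ := by
  rw [TensorProduct.map_ker (f.exact_subtype_ker_map) hf (g.exact_subtype_ker_map) hg,
    LinearMap.lTensor, LinearMap.rTensor, TensorProduct.range_map, TensorProduct.range_map]
  simp

theorem comap_shuffle₂_map_j {W V : Type u} [AddCommGroup W] [Module k W] [AddCommGroup V]
    [Module k V] (φ : Cochain2 k W) (ψ : Cochain2 k V) (r s : ℕ)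
    (S : Submodule k (((⨂[k]^r W) ⊗[k] (⨂[k]^s W)) ⊗[k] ((⨂[k]^r V) ⊗[k] (⨂[k]^s V)))) :
    (S.comap (shuffle₂ r s).toLinearMap).map (Cochain2.j φ ψ r s).toLinearMap =
      (S.map (TensorProduct.map (φ r s).toLinearMap (ψ r s).toLinearMap)).comap
        (shuffle₂ r s).toLinearMap := by
  have hsurj : Function.Surjective
    (shuffle₂ (k := k) (W := W) (V := V) r s).toLinearMap := (shuffle₂ r s).surjective
  apply Submodule.map_injective_of_injective
    (f := (shuffle₂ (k := k) (W := W) (V := V) r s).toLinearMap) (shuffle₂ r s).injective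
  rw [Submodule.map_comap_eq_of_surjective hsurj]
  conv_rhs => rw [← Submodule.map_comap_eq_of_surjective hsurj S]
  rw [← Submodule.map_comp, ← Submodule.map_comp]
  congr 1
  refine LinearMap.ext fun u => ?_
  simp only [LinearMap.comp_apply, LinearEquiv.coe_coe, Cochain2.j, LinearEquiv.trans_apply,
    LinearEquiv.apply_symm_apply]
  rfl

namespace CA

theorem Admissible.of_equiv {C C' : CA k} (e : C.V ≃ₗ[k] C'.V)
    (he : ∀ n, C.I.deg n = (C'.I.deg n).comap (pw e.toLinearMap n)) {ψ : Cochain2 k C.V}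
    {ψ' : Cochain2 k C'.V} (hψ : ∀ r s u,
      ψ' r s (TensorProduct.map (pw e.toLinearMap r) (pw e.toLinearMap s) u) =
        TensorProduct.map (pw e.toLinearMap r) (pw e.toLinearMap s) (ψ r s u))
    (h : C.Admissible ψ) : C'.Admissible ψ' := by
  have hmap : ∀ n, (C.I.deg n).map (pw e.toLinearMap n) = C'.I.deg n := fun n => by
    rw [he]
    exact Submodule.map_comap_eq_of_surjective (pwEquiv e n).surjective _
  have htop : ∀ n, (⊤ : Submodule k (⨂[k]^n C.V)).map (pw e.toLinearMap n) = ⊤ := fun n => by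
    rw [Submodule.map_top]
    exact LinearEquiv.range (pwEquiv e n)
  have hrel : ∀ r s, C'.rel₂ r s =
      (C.rel₂ r s).map (TensorProduct.map (pw e.toLinearMap r) (pw e.toLinearMap s)) := by
    intro r s
    rw [rel₂_eq, rel₂_eq, Submodule.map_sup, tens_map, tens_map, htop, htop, hmap, hmap]
  intro r s
  rw [hrel, ← Submodule.map_comp]
  conv_rhs => rw [← h r s, ← Submodule.map_comp]
  congr 1
  exact LinearMap.ext (hψ r s)

/-- Each component of `𝒞 ∘ ℬ` embeds in `𝐂ₙ ⊗ 𝐁ₙ`, and over a field tensor products of injections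
are injective. The kernel can therefore be computed in a fourfold tensor product, whose factors are
regrouped as `(𝐂ᵣ ⊗ 𝐂ₛ) ⊗ (𝐁ᵣ ⊗ 𝐁ₛ)`. -/
theorem circ_rel₂ (C B : CA k) (r s : ℕ) :
    (C.circ B).rel₂ r s = (tens ⊤ (B.rel₂ r s) ⊔ tens (C.rel₂ r s) ⊤).comap
      (shuffle₂ (k := k) (W := C.V) (V := B.V) r s).toLinearMap := by
  let q : ∀ n, (⨂[k]^n (C.V ⊗[k] B.V)) →ₗ[k] C.Comp n ⊗[k] B.Comp n := fun n =>
    TensorProduct.map (C.proj n) (B.proj n) ∘ₗ (shuffle n).toLinearMap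
  let ι : ∀ n, (C.circ B).Comp n →ₗ[k] C.Comp n ⊗[k] B.Comp n := fun n =>
    (LinearMap.ker (q n)).liftQ (q n) le_rfl
  have hι : ∀ n, Function.Injective (ι n) := fun n => by
    rw [← LinearMap.ker_eq_bot]
    exact Submodule.ker_liftQ_eq_bot _ _ _ le_rfl
  have h1 : (C.circ B).rel₂ r s = LinearMap.ker (TensorProduct.map (q r) (q s)) := by
    have hinj : Function.Injective (TensorProduct.map (ι r) (ι s)) :=
      TensorProduct.map_injective_of_flat_flat _ _ (hι r) (hι s)
    have e : TensorProduct.map (q r) (q s) = TensorProduct.map (ι r) (ι s) ∘ₗ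
        TensorProduct.map ((C.circ B).proj r) ((C.circ B).proj s) := by
      rw [← TensorProduct.map_comp]
      rfl
    exact ((congrArg LinearMap.ker e).trans
      (by ext x; exact (map_eq_zero_iff _ hinj))).symm
  rw [h1, rel₂, rel₂, ← ker_map_of_surjective (C.map_proj_surjective r s)
    (B.map_proj_surjective r s), ← LinearMap.ker_comp]
  have e : TensorProduct.map (TensorProduct.map (C.proj r) (C.proj s))
      (TensorProduct.map (B.proj r) (B.proj s)) ∘ₗ (shuffle₂ r s).toLinearMap =
      (TensorProduct.tensorTensorTensorComm k _ _ _ _).toLinearMap ∘ₗ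
        TensorProduct.map (q r) (q s) := by
    rw [TensorProduct.map_comp, ← LinearMap.comp_assoc]
    have e' : TensorProduct.map (TensorProduct.map (C.proj r) (C.proj s))
        (TensorProduct.map (B.proj r) (B.proj s)) ∘ₗ
          (TensorProduct.tensorTensorTensorComm k (⨂[k]^r C.V) (⨂[k]^r B.V) (⨂[k]^s C.V)
            (⨂[k]^s B.V)).toLinearMap =
        (TensorProduct.tensorTensorTensorComm k _ _ _ _).toLinearMap ∘ₗ
          TensorProduct.map (TensorProduct.map (C.proj r) (B.proj r))
            (TensorProduct.map (C.proj s) (B.proj s)) := by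
      apply TensorProduct.ext_fourfold'
      intro a b c d
      simp
    rw [← e']
    rfl
  rw [e, LinearMap.ker_comp_of_ker_eq_bot _ (LinearEquiv.ker _)]

theorem Admissible.circ {C B : CA k} {φ : Cochain2 k C.V} {ψ : Cochain2 k B.V}
    (hφ : C.Admissible φ) (hψ : B.Admissible ψ) : (C.circ B).Admissible (Cochain2.j φ ψ) := by
  intro r s
  rw [circ_rel₂]
  have htop : (⊤ : Submodule k ((⨂[k]^r C.V) ⊗[k] ⨂[k]^s C.V)).map (φ r s).toLinearMap = ⊤ := by
    rw [Submodule.map_top, LinearEquiv.range]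
  have htop' : (⊤ : Submodule k ((⨂[k]^r B.V) ⊗[k] ⨂[k]^s B.V)).map (ψ r s).toLinearMap = ⊤ := by
    rw [Submodule.map_top, LinearEquiv.range]
  refine (comap_shuffle₂_map_j φ ψ r s _).trans ?_
  rw [Submodule.map_sup, tens_map, tens_map, htop, htop', hφ, hψ]

end CA

end Admissibility

namespace CA

variable {k : Type u} [Field k]

/-! ### Morphisms to twisted spaces -/

theorem Hom.onComp_proj {A B : CA k} (f : Hom A B) (n : ℕ) (x : ⨂[k]^n A.V) :
    f.onComp n (A.proj n x) = B.proj n (pw f.lin n x) := rfl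

theorem pw_pwOne_symm {V W : Type u} [AddCommGroup V] [Module k V] [AddCommGroup W] [Module k W]
    (f : V →ₗ[k] W) (v : V) : pw f 1 (pwOne.symm v) = pwOne.symm (f v) := by
  rw [pwOne_symm, pwOne_symm, pw_tprod]

theorem pw_tone {V W : Type u} [AddCommGroup V] [Module k V] [AddCommGroup W] [Module k W]
    (f : V →ₗ[k] W) : pw f 0 (tone k V) = tone k W := by
  rw [tone, tone, pw_tprod]
  congr 1
  exact funext fun i => i.elim0

theorem genEquiv_apply (A : CA k) (v : A.V) : A.genEquiv v = A.proj 1 (pwOne.symm v) := rfl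

theorem isHomToTwist_of_proj {A C : CA k} {ψ : Z2 k C.V} {h : C.Admissible ψ.toFun}
    {φ : ∀ n, A.Comp n →ₗ[k] C.Comp n} (f : A.V →ₗ[k] C.V)
    (hφ : ∀ n x, φ n (A.proj n x) = C.proj n (prim ψ.toFun n (pw f n x))) :
    IsHomToTwist A C ψ.toFun h φ := by
  constructor
  · rw [unit, hφ, pw_tone]
    rfl
  · intro r s x y
    obtain ⟨x, rfl⟩ := Submodule.mkQ_surjective _ x
    obtain ⟨y, rfl⟩ := Submodule.mkQ_surjective _ y
    rw [mul_proj, hφ, hφ, hφ, ← TensorProduct.map_tmul, twMul_proj, pw_mu, prim_mu]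

/-- `𝐀` is generated in degree one, and the twisted product of `n` generators is the primitive
applied to their tensor product. -/
theorem IsHomToTwist.proj {A C : CA k} {ψ : Z2 k C.V} {h : C.Admissible ψ.toFun}
    {φ : ∀ n, A.Comp n →ₗ[k] C.Comp n} (hφ : IsHomToTwist A C ψ.toFun h φ) {f : A.V →ₗ[k] C.V}
    (hf : ∀ a, φ 1 (A.genEquiv a) = C.genEquiv (f a)) (n : ℕ) (x : ⨂[k]^n A.V) :
    φ n (A.proj n x) = C.proj n (prim ψ.toFun n (pw f n x)) := by
  induction n with
  | zero =>
    obtain ⟨c, rfl⟩ := exists_smul_tone x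
    simp only [map_smul, pw_tone]
    exact congrArg (c • ·) hφ.1
  | succ n ih =>
    obtain ⟨u, rfl⟩ := (mu (k := k) (V := A.V) n 1).surjective x
    induction u using TensorProduct.induction_on with
    | zero => simp
    | add u v hu hv => simp only [map_add, hu, hv]
    | tmul x v =>
      obtain ⟨a, rfl⟩ := (pwOne (k := k) (V := A.V)).symm.surjective v
      rw [← mul_proj, hφ.2, ih, ← genEquiv_apply, hf, genEquiv_apply, ← TensorProduct.map_tmul,
        twMul_proj, pw_mu, prim_succ, pw_pwOne_symm]

/-- Vanishing in `𝐂ₙ ⊗ 𝐁ₙ` is tested by functionals on `𝐁ₙ`, which are precisely the functionals on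
`𝐁₁^{⊗n}` that kill the relations. -/
theorem mem_circ_deg (C B : CA k) {n : ℕ} (y : ⨂[k]^n (C.V ⊗[k] B.V)) :
    y ∈ (C.circ B).I.deg n ↔
      ∀ F ∈ B.perp n, contract _ (dualPw n F) (shuffle n y) ∈ C.I.deg n := by
  change TensorProduct.map (C.proj n) (B.proj n) (shuffle n y) = 0 ↔ _
  constructor
  · intro hy F hF
    have hF' : B.I.deg n ≤ LinearMap.ker (dualPw n F) :=
      fun x hx => (Submodule.mem_dualAnnihilator _).1 hF x hx
    have h := contract_map ((B.I.deg n).liftQ _ hF') (C.proj n) (B.proj n) (shuffle n y)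
    rw [hy, map_zero] at h
    exact (Submodule.Quotient.mk_eq_zero _).1 h.symm
  · intro h
    apply contract_ext
    intro g
    rw [map_zero, contract_map]
    apply (Submodule.Quotient.mk_eq_zero _).2
    have := h ((dualPw n).symm (g ∘ₗ B.proj n)) (by
      rw [perp, Submodule.mem_comap, LinearEquiv.coe_coe, LinearEquiv.apply_symm_apply,
        Submodule.mem_dualAnnihilator]
      intro x hx
      rw [LinearMap.comp_apply, Submodule.mkQ_apply, (Submodule.Quotient.mk_eq_zero _).2 hx,
        map_zero])
    rwa [LinearEquiv.apply_symm_apply] at this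

/-- This is where the factor `𝕀^{⊗2}` of a factorizable collection enters: a cochain that is trivial
on `V` commutes with contraction of `V`. -/
theorem contract_shuffle_j_refl {W V : Type u} [AddCommGroup W] [Module k W] [AddCommGroup V]
    [Module k V] (θ : Cochain1 k W) {n : ℕ} (g : Module.Dual k (⨂[k]^n V))
    (y : ⨂[k]^n (W ⊗[k] V)) :
    contract _ g (shuffle n (Cochain1.j θ (fun _ => LinearEquiv.refl k _) n y)) =
      θ n (contract _ g (shuffle n y)) := by
  simp only [Cochain1.j, LinearEquiv.trans_apply, LinearEquiv.apply_symm_apply]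
  exact contract_map g (θ n).toLinearMap LinearMap.id (shuffle n y)

theorem contract_shuffle_pw {W W' V : Type u} [AddCommGroup W] [Module k W] [AddCommGroup W']
    [Module k W'] [AddCommGroup V] [Module k V] (p : W →ₗ[k] W') {n : ℕ}
    (g : Module.Dual k (⨂[k]^n V)) (y : ⨂[k]^n (W ⊗[k] V)) :
    contract _ g (shuffle n (pw (TensorProduct.map p LinearMap.id) n y)) =
      pw p n (contract _ g (shuffle n y)) := by
  rw [shuffle_pw, contract_map, pw_id, LinearMap.comp_id]

/-! ### Isomorphisms -/

/-- The linear equivalence of the spaces of generators given by an isomorphism. -/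
def linEquiv {C C' : CA k} (i : C ≅ C') : C.V ≃ₗ[k] C'.V :=
  LinearEquiv.ofLinearMap (Hom.lin i.hom) (Hom.lin i.inv)
    (congrArg Hom.lin i.inv_hom_id) (congrArg Hom.lin i.hom_inv_id)

theorem deg_eq_comap_linEquiv {C C' : CA k} (i : C ≅ C') (n : ℕ) :
    C.I.deg n = (C'.I.deg n).comap (pw (linEquiv i).toLinearMap n) := by
  apply le_antisymm
  · exact Hom.map_rel i.hom n
  · intro x hx
    have := Hom.map_rel i.inv n hx
    rw [Submodule.mem_comap, ← LinearMap.comp_apply, ← pw_comp] at this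
    have e : Hom.lin i.inv ∘ₗ (linEquiv i).toLinearMap = LinearMap.id :=
      congrArg Hom.lin i.hom_inv_id
    rwa [e, pw_id] at this

/-- The subalgebra generated by all the generators. -/
def subIso (A : CA k) {U : Submodule k A.V} (hU : U = ⊤) : A.sub U ≅ A where
  hom := A.incl U
  inv := ⟨LinearMap.id.codRestrict U fun x => hU ▸ trivial, fun n x hx => by
    change pw U.subtype n (pw _ n x) ∈ A.I.deg n
    rw [← LinearMap.comp_apply, ← pw_comp, LinearMap.subtype_comp_codRestrict, pw_id]
    exact hx⟩
  hom_inv_id := Hom.ext rfl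
  inv_hom_id := Hom.ext rfl

/-! ### The universal object -/

section Universal

variable {A B : CA k}

/-- The identity `𝐁₁^* ⊗ 𝐀₁ → D₁`. -/
def toD₁ (B A : CA k) : Module.Dual k B.V ⊗[k] A.V →ₗ[k] B.D₁ A := LinearMap.id

/-- The map `𝐀₁ → (𝐁₁^* ⊗ 𝐀₁) ⊗ 𝐁₁`. -/
def unitMap (B A : CA k) : A.V →ₗ[k] B.D₁ A ⊗[k] B.V := coev (toD₁ B A)

theorem contract_unitMap (f : Module.Dual k B.V) (a : A.V) :
    contract _ f (unitMap B A a) = toD₁ B A (f ⊗ₜ a) :=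
  contract_coev _ f a

/-- The relations `θ(J^⊥ ⊗ I)` on `𝐁₁^* ⊗ 𝐀₁`. -/
def IsTwistedRel (ξ : Z2 k (B.D₁ A)) (I : GIdeal k (B.D₁ A)) : Prop :=
  ∀ n, ∀ F ∈ B.perp n, ∀ x ∈ A.I.deg n,
    prim ξ.toFun n (pw (toD₁ B A) n ((shuffle n).symm (F ⊗ₜ x))) ∈ I.deg n

variable {ξ : Z2 k (B.D₁ A)} {I : GIdeal k (B.D₁ A)} (h0 : I.deg 0 = ⊥) (h1 : I.deg 1 = ⊥)

/-- The quantum space generated by `𝐁₁^* ⊗ 𝐀₁` with relations `I`. -/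
abbrev onD₁ (I : GIdeal k (B.D₁ A)) (h0 : I.deg 0 = ⊥) (h1 : I.deg 1 = ⊥) : CA k :=
  CA.mk (B.D₁ A) I h0 h1

/-- By the contraction test the images of relations vanish exactly because `I` contains the elements
`θ(F ⊗ x)`. -/
theorem unitMap_rel (hI : IsTwistedRel ξ I) (n : ℕ) : A.I.deg n ≤ LinearMap.ker (((onD₁ I h0 h1).circ B).proj n ∘ₗ
    (prim (ξ.j (Z2.one k B.V)).toFun n).toLinearMap ∘ₗ pw (unitMap B A) n) := by
  intro x hx
  apply (Submodule.Quotient.mk_eq_zero _).2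
  refine (mem_circ_deg (onD₁ I h0 h1) B _).2 fun F hF => ?_
  have h := contract_shuffle_j_refl (prim ξ.toFun) (dualPw n F) (pw (unitMap B A) n x)
  have h' := contract_shuffle_coev (toD₁ B A) F x
  rw [prim_j, prim_one_cochain]
  refine Eq.mpr (congrArg (· ∈ I.deg n) (h.trans (congrArg _ h'))) ?_
  exact hI n F hF x hx

variable (hI : IsTwistedRel ξ I)

/-- The components `𝐀ₙ → 𝐃ₙ ⊗ 𝐁ₙ` of the universal diagram. -/
def unitComp (n : ℕ) : A.Comp n →ₗ[k] ((onD₁ I h0 h1).circ B).Comp n :=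
  (A.I.deg n).liftQ _ (unitMap_rel h0 h1 hI n)

/-- The universal diagram. -/
def univ : HComma A B :=
  StructuredArrow.mk (S := (forgetGr k).obj A) (T := circRight B ⋙ forgetGr k)
    (Y := onD₁ I h0 h1) (fun n => ModuleCat.ofHom (unitComp h0 h1 hI n))

/-- No twist is visible in degree one, since primitives are the identity there. -/
theorem univ_φ₁ (a : A.V) : (univ h0 h1 hI).φ₁ a = unitMap B A a := by
  change ((onD₁ I h0 h1).circ B).genEquiv.symm (unitComp h0 h1 hI 1 (A.genEquiv a)) = _
  refine (LinearEquiv.symm_apply_eq _).2 ?_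
  have h := prim_one (ξ.j (Z2.one k B.V)) (pw (unitMap B A) 1 (pwOne.symm a))
  exact congrArg (((onD₁ I h0 h1).circ B).proj 1) (h.trans (pw_pwOne_symm _ a))

theorem univ_coeff : (univ h0 h1 hI).coeff = toD₁ B A := by
  apply TensorProduct.ext'
  intro f a
  rw [HComma.coeff_tmul, univ_φ₁]
  exact contract_unitMap f a

theorem univ_H₁ : (univ h0 h1 hI).H₁ = ⊤ := by
  rw [HComma.H₁, univ_coeff]
  exact LinearMap.range_id

/-- Here `𝐇₁^φ` is the whole space of generators, but `ℋ^φ` is only isomorphic to `ℋ`; the cocycle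
and its admissibility are transported along that isomorphism. -/
theorem univ_isOmega (hξ : (onD₁ I h0 h1).Admissible ξ.toFun) :
    IsOmega (ξ.j (Z2.one k B.V)) (univ h0 h1 hI) := by
  let X := univ h0 h1 hI
  let i : X.F ≅ onD₁ I h0 h1 := subIso _ (univ_H₁ h0 h1 hI)
  let j : (onD₁ I h0 h1).circ B ≅ X.F.circ B := (circRight B).mapIso i.symm
  let ω : Z2 k ((onD₁ I h0 h1).circ B).V := ξ.j (Z2.one k B.V)
  have hadm : ((onD₁ I h0 h1).circ B).Admissible ω.toFun :=
    Admissible.circ hξ B.admissible_one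
  have hπ : X.π = Hom.lin i.inv := by
    refine LinearMap.ext fun x => Subtype.ext ?_
    exact LinearMap.congr_fun (univ_coeff h0 h1 hI) x
  have hadm' : (X.F.circ B).Admissible (ω.transport (linEquiv j)).toFun :=
    hadm.of_equiv (linEquiv j) (deg_eq_comap_linEquiv j) (ω.transport_apply (linEquiv j))
  refine ⟨ω.transport (linEquiv j), ?_, hadm', fun n => (Hom.onComp j.hom n) ∘ₗ
    unitComp h0 h1 hI n, ?_, ?_⟩
  · intro r s u
    have := ω.transport_apply (linEquiv j) r s u
    rw [hπ]
    exact this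
  · intro n
    have e : ((forgetGr k).map j.hom n) ≫ ((forgetGr k).map j.inv n) = 𝟙 _ := by
      have := congrFun ((forgetGr k).congr_map j.hom_inv_id) n
      rw [Functor.map_comp, CategoryTheory.Functor.map_id] at this
      exact this
    have e' := congrArg ModuleCat.Hom.hom e
    exact congrArg (· ∘ₗ unitComp h0 h1 hI n) e'
  · let f : A.V →ₗ[k] ((onD₁ I h0 h1).circ B).V := unitMap B A
    refine isHomToTwist_of_proj ((linEquiv j).toLinearMap ∘ₗ f) fun n x => ?_
    have h := prim_pw (ω.transport_apply (linEquiv j)) n (pw f n x)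
    have h' := LinearMap.congr_fun (pw_comp (linEquiv j).toLinearMap f n) x
    exact congrArg ((X.F.circ B).proj n) (h.symm.trans (congrArg (prim _ n) h'.symm))

end Universal

end CA

namespace CA

variable {k : Type u} [Field k]

/-! ### Initiality of the universal object -/

/-- The preimage of a graded ideal under the algebra map induced by a linear map. -/
def _root_.QSpace.GIdeal.comap {V W : Type u} [AddCommGroup V] [Module k V] [AddCommGroup W]
    [Module k W] (J : GIdeal k W) (f : V →ₗ[k] W) : GIdeal k V where
  deg n := (J.deg n).comap (pw f n)
  mul_left r s x y hy := by
    rw [Submodule.mem_comap] at hy ⊢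
    rw [pw_mu]
    exact J.mul_left r s _ _ hy
  mul_right r s x y hx := by
    rw [Submodule.mem_comap] at hx ⊢
    rw [pw_mu]
    exact J.mul_right r s _ _ hx

section Universal

variable {A B : CA k} {ξ : Z2 k (B.D₁ A)} {I : GIdeal k (B.D₁ A)} {h0 : I.deg 0 = ⊥}
  {h1 : I.deg 1 = ⊥}

theorem contract_φ₁ (X : HComma A B) (f : Module.Dual k B.V) (a : A.V) :
    contract _ f (X.φ₁ a) = X.coeff (f ⊗ₜ a) := rfl

theorem map_coeff_unitMap (X : HComma A B) {c : B.D₁ A →ₗ[k] X.right.V}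
    (hc : ∀ z, c (toD₁ B A z) = X.coeff z) (a : A.V) :
    TensorProduct.map c LinearMap.id (unitMap B A a) = X.φ₁ a := by
  apply contract_ext
  intro f
  rw [contract_map, LinearMap.comp_id, contract_unitMap, hc, contract_φ₁]

theorem genEquiv_φ₁ (X : HComma A B) (a : A.V) :
    (X.right.circ B).genEquiv (X.φ₁ a) = X.φ 1 (A.genEquiv a) :=
  LinearEquiv.apply_symm_apply _ _

theorem onComp_genEquiv {C C' : CA k} (f : Hom C C') (v : C.V) :
    f.onComp 1 (C.genEquiv v) = C'.genEquiv (f.lin v) := by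
  rw [genEquiv_apply, Hom.onComp_proj, pw_pwOne_symm, genEquiv_apply]

/-- The map of generators `D₁ → 𝐇₁` given by an object of `Ω`. -/
def coeffD₁ (X : HComma A B) : B.D₁ A →ₗ[k] X.right.V := X.coeff

/-- The map `D₁ ⊗ 𝐁₁ → 𝐇₁^φ ⊗ 𝐁₁`. -/
def πB (X : HComma A B) : B.D₁ A ⊗[k] B.V →ₗ[k] (X.F.circ B).V :=
  TensorProduct.map X.π LinearMap.id

/-! ### The constraint on the relations of an object of `Ω`. -/

section Object

variable {X : HComma A B} {ω' : Z2 k (X.F.circ B).V}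
  {h : (X.F.circ B).Admissible ω'.toFun} {φ' : ∀ n, A.Comp n →ₗ[k] (X.F.circ B).Comp n}

theorem proj_of_isHomToTwist (htr : X.Translates (ξ.j (Z2.one k B.V)) ω')
    (hφ : ∀ n, ((X.right.incl X.H₁).circRight B).onComp n ∘ₗ φ' n = X.φ n)
    (hhom : IsHomToTwist A (X.F.circ B) ω'.toFun h φ') (n : ℕ) (x : ⨂[k]^n A.V) :
    φ' n (A.proj n x) = (X.F.circ B).proj n
      (pw (πB X) n (prim (ξ.j (Z2.one k B.V)).toFun n (pw (unitMap B A) n x))) := by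
  -- Flatness over a field: `𝐇₁^φ ⊗ 𝐁₁` embeds in `𝐇₁ ⊗ 𝐁₁`, so `φ` determines the degree-one part
  -- of its corestriction.
  have hinj : Function.Injective (((X.right.incl X.H₁).circRight B).lin) :=
    TensorProduct.map_injective_of_flat_flat X.H₁.subtype LinearMap.id
      X.H₁.injective_subtype Function.injective_id
  have hf : ∀ a, φ' 1 (A.genEquiv a) = (X.F.circ B).genEquiv ((πB X ∘ₗ unitMap B A) a) := by
    intro a
    obtain ⟨v, hv⟩ := (X.F.circ B).genEquiv.surjective (φ' 1 (A.genEquiv a))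
    rw [← hv]
    congr 1
    apply hinj
    have e1 := LinearMap.congr_fun (hφ 1) (A.genEquiv a)
    have e2 := (onComp_genEquiv ((X.right.incl X.H₁).circRight B) v).symm.trans
      ((congrArg (Hom.onComp ((X.right.incl X.H₁).circRight B) 1) hv).trans
        (e1.trans (genEquiv_φ₁ X a).symm))
    have e3 := (X.right.circ B).genEquiv.injective e2
    refine e3.trans ?_
    rw [← map_coeff_unitMap X (c := coeffD₁ X) (fun _ => rfl)]
    have e4 := LinearMap.congr_fun (TensorProduct.map_comp X.H₁.subtype
      (LinearMap.id : B.V →ₗ[k] B.V) X.π LinearMap.id) (unitMap B A a)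
    exact e4
  have h2 := prim_pw (p := πB X) htr n (pw (unitMap B A) n x)
  rw [hhom.proj hf, pw_comp]
  exact congrArg ((X.F.circ B).proj n) h2

/-- Since `φ` kills `x ∈ Iₙ`, the formula for `φ` on products of generators gives an element that
vanishes in `ℋ^φ ∘ ℬ`. Its contraction with `F ∈ Jₙ^⊥` is the image of `θ(F ⊗ x)`. -/
theorem coeffD₁_rel (htr : X.Translates (ξ.j (Z2.one k B.V)) ω')
    (hφ : ∀ n, ((X.right.incl X.H₁).circRight B).onComp n ∘ₗ φ' n = X.φ n)
    (hhom : IsHomToTwist A (X.F.circ B) ω'.toFun h φ') :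
    IsTwistedRel ξ (X.right.I.comap (coeffD₁ X)) := by
  intro n F hF x hx
  have e := proj_of_isHomToTwist htr hφ hhom n x
  rw [Submodule.mkQ_apply, (Submodule.Quotient.mk_eq_zero _).2 hx, map_zero] at e
  have e1 := (mem_circ_deg X.F B _).1 ((Submodule.Quotient.mk_eq_zero _).1 e.symm) F hF
  have e2 := contract_shuffle_pw X.π (dualPw n F)
    (prim (ξ.j (Z2.one k B.V)).toFun n (pw (unitMap B A) n x))
  have e3 := contract_shuffle_j_refl (V := B.V) (prim ξ.toFun) (dualPw n F)
    (pw (unitMap B A) n x)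
  have e4 := contract_shuffle_coev (toD₁ B A) F x
  rw [prim_j, prim_one_cochain] at e1 e2
  have e6 := e2.trans (congrArg (pw X.π n) (e3.trans (congrArg (prim ξ.toFun n) e4)))
  have e7 := Eq.mp (congrArg (· ∈ X.F.I.deg n) e6) e1
  have e8 := LinearMap.congr_fun (pw_comp X.H₁.subtype X.π n)
    (prim ξ.toFun n (pw (toD₁ B A) n ((shuffle n).symm (F ⊗ₜ x))))
  exact Eq.mpr (congrArg (· ∈ X.right.I.deg n) e8) e7

end Object

variable (hI : IsTwistedRel ξ I)
  (hmin : ∀ J : GIdeal k (B.D₁ A), IsTwistedRel ξ J → ∀ n, I.deg n ≤ J.deg n)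

/-- Minimality of `I` makes `b^j ⊗ a ↦ h^j(a)` a morphism of quantum spaces. The triangle commutes
because both sides are the same primitive followed by maps induced from generators. -/
theorem exists_hom_of_isOmega {X : HComma A B} (hX : IsOmega (ξ.j (Z2.one k B.V)) X)
    (hmin : ∀ J : GIdeal k (B.D₁ A), IsTwistedRel ξ J → ∀ n, I.deg n ≤ J.deg n) :
    Nonempty (univ h0 h1 hI ⟶ X) := by
  obtain ⟨ω', htr, hadm, φ', hφ, hhom⟩ := hX
  let α : Hom (onD₁ I h0 h1) X.right :=
    ⟨coeffD₁ X, hmin _ (coeffD₁_rel htr hφ hhom)⟩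
  refine ⟨StructuredArrow.homMk (α : onD₁ I h0 h1 ⟶ X.right) ?_⟩
  funext n
  apply ModuleCat.hom_ext
  apply Submodule.linearMap_qext
  refine LinearMap.ext fun x => ?_
  have e1 := LinearMap.congr_fun (hφ n) (A.proj n x)
  have e4 := congrArg (Hom.onComp ((X.right.incl X.H₁).circRight B) n)
    (proj_of_isHomToTwist htr hφ hhom n x)
  refine Eq.trans ?_ (e4.symm.trans e1)
  have e2 := LinearMap.congr_fun (pw_comp ((X.right.incl X.H₁).circRight B).lin (πB X) n)
    (prim (ξ.j (Z2.one k B.V)).toFun n (pw (unitMap B A) n x))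
  have e3 : ((X.right.incl X.H₁).circRight B).lin ∘ₗ πB X =
      TensorProduct.map (coeffD₁ X) LinearMap.id :=
    (TensorProduct.map_comp X.H₁.subtype (LinearMap.id : B.V →ₗ[k] B.V) X.π LinearMap.id).symm
  rw [e3] at e2
  exact congrArg ((X.right.circ B).proj n) e2

/-- The triangle in degree one, contracted with functionals on `𝐁₁`, prescribes the morphism on
every generator `f ⊗ a`. -/
theorem hom_ext_of_univ {X : HComma A B} (f g : univ h0 h1 hI ⟶ X) : f = g := by
  have key : ∀ f : univ h0 h1 hI ⟶ X, ∀ z, Hom.lin f.right (toD₁ B A z) = X.coeff z := by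
    intro f
    let l : B.D₁ A →ₗ[k] X.right.V := Hom.lin (A := onD₁ I h0 h1) f.right
    have hw := fun a => congrArg (fun m => ModuleCat.Hom.hom (m 1) (A.genEquiv a))
      (StructuredArrow.w f)
    have hlin : ∀ a, TensorProduct.map l LinearMap.id (unitMap B A a) =
        X.φ₁ a := by
      intro a
      apply (X.right.circ B).genEquiv.injective
      rw [genEquiv_φ₁]
      refine Eq.trans ?_ (hw a)
      have e1 := onComp_genEquiv (Hom.circRight f.right B) (unitMap B A a)
      have e2 := genEquiv_φ₁ (univ h0 h1 hI) a
      rw [univ_φ₁] at e2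
      exact e1.symm.trans (congrArg (Hom.onComp (Hom.circRight f.right B) 1) e2)
    have : l ∘ₗ toD₁ B A = X.coeff := by
      apply TensorProduct.ext'
      intro F a
      rw [← contract_φ₁, ← hlin, contract_map, LinearMap.comp_id, contract_unitMap]
      rfl
    exact fun z => LinearMap.congr_fun this z
  apply StructuredArrow.hom_ext
  apply Hom.ext
  refine LinearMap.ext fun z => ?_
  exact (key f z).trans (key g z).symm

/-- The universal object of `Ω`. -/
def univOmega (hξ : (onD₁ I h0 h1).Admissible ξ.toFun) : Omega A B (ξ.j (Z2.one k B.V)) :=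
  ⟨univ h0 h1 hI, univ_isOmega h0 h1 hI hξ⟩

theorem univOmega_isInitial (hξ : (onD₁ I h0 h1).Admissible ξ.toFun)
    (hmin : ∀ J : GIdeal k (B.D₁ A), IsTwistedRel ξ J → ∀ n, I.deg n ≤ J.deg n) :
    Nonempty (Limits.IsInitial (univOmega hI hξ)) :=
  ⟨Limits.IsInitial.ofUniqueHom
    (fun X => ObjectProperty.homMk (exists_hom_of_isOmega hI X.property hmin).some)
    (fun _ _ => ObjectProperty.hom_ext _ (hom_ext_of_univ hI _ _))⟩

end Universal

end CA

namespace CA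

variable {k : Type u} [Field k]

/-! ### The universal relations -/

theorem shuffle_symm_mem_shuffleS {W V : Type u} [AddCommGroup W] [Module k W] [AddCommGroup V]
    [Module k V] {n : ℕ} {P : Submodule k (⨂[k]^n W)} {Q : Submodule k (⨂[k]^n V)}
    {x : ⨂[k]^n W} {y : ⨂[k]^n V} (hx : x ∈ P) (hy : y ∈ Q) :
    (shuffle n).symm (x ⊗ₜ y) ∈ shuffleS P Q := by
  rw [shuffleS, Submodule.mem_comap, LinearEquiv.coe_coe, LinearEquiv.apply_symm_apply]
  exact tmul_mem_tens hx hy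

theorem shuffleS_le {W V : Type u} [AddCommGroup W] [Module k W] [AddCommGroup V]
    [Module k V] {n : ℕ} {P : Submodule k (⨂[k]^n W)} {Q : Submodule k (⨂[k]^n V)}
    {S : Submodule k (⨂[k]^n (W ⊗[k] V))}
    (h : ∀ x ∈ P, ∀ y ∈ Q, (shuffle n).symm (x ⊗ₜ y) ∈ S) : shuffleS P Q ≤ S := by
  intro z hz
  have h' : tens P Q ≤ S.comap (shuffle n).symm.toLinearMap := tens_le.2 h
  have := h' hz
  rwa [Submodule.mem_comap, LinearEquiv.coe_coe, LinearEquiv.coe_coe,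
    LinearEquiv.symm_apply_apply] at this

/-! ### The universal relations are those of the twisted `▷`. -/

section

variable {B A : CA k} {β : Z2 k B.V} {α : Z2 k A.V}

theorem map_triRel (hβ : B.SecondAdmissible β.inv.toFun) (hα : A.SecondAdmissible α.inv.toFun)
    (n : ℕ) : (B.triRel A n).map (triCochain β α n).toLinearMap =
      (B.twist β.inv hβ.1).triRel (A.twist α.inv hα.1) n := by
  have h1 := shuffleS_map (prim β.toFun).dual (prim α.toFun) (perpS (B.I.deg n)) (A.I.deg n)
  rw [perpS_map, ← twist_inv_deg B β hβ.1, ← twist_inv_deg A α hα.1] at h1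
  exact h1

theorem shuffle_symm_mem_triRel {n : ℕ} {F : ⨂[k]^n (Module.Dual k B.V)} {x : ⨂[k]^n A.V}
    (hF : F ∈ B.perp n) (hx : x ∈ A.I.deg n) : (shuffle n).symm (F ⊗ₜ x) ∈ B.triRel A n :=
  shuffle_symm_mem_shuffleS hF hx

theorem triRel_le {n : ℕ} {S : Submodule k (⨂[k]^n (Module.Dual k B.V ⊗[k] A.V))}
    (h : ∀ F ∈ B.perp n, ∀ x ∈ A.I.deg n, (shuffle n).symm (F ⊗ₜ x) ∈ S) :
    B.triRel A n ≤ S :=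
  shuffleS_le h

theorem prim_pw_toD₁ (β : Z2 k B.V) (α : Z2 k A.V) (n : ℕ)
    (z : ⨂[k]^n (Module.Dual k B.V ⊗[k] A.V)) :
    prim (Z2.j β.dual α).toFun n
      (pw (V := Module.Dual k B.V ⊗[k] A.V) (W := B.D₁ A) (toD₁ B A) n z) = triCochain β α n z :=
  (congrArg (prim (Z2.j β.dual α).toFun n)
    (LinearMap.congr_fun (pw_id (V := Module.Dual k B.V ⊗[k] A.V) n) z)).trans
    (LinearEquiv.congr_fun (congrFun (prim_j_dual β α) n) z)

theorem isTwistedRel_tri (hβ : B.SecondAdmissible β.inv.toFun)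
    (hα : A.SecondAdmissible α.inv.toFun) :
    IsTwistedRel (A := A) (B := B) (Z2.j β.dual α)
      ((B.twist β.inv hβ.1).tri (A.twist α.inv hα.1)).I := by
  intro n F hF x hx
  have h1 := Submodule.mem_map_of_mem (f := (triCochain β α n).toLinearMap)
    (shuffle_symm_mem_triRel hF hx)
  have h2 := GIdeal.le_gen
    (V := Module.Dual k (B.twist β.inv hβ.1).V ⊗[k] (A.twist α.inv hα.1).V)
    ((B.twist β.inv hβ.1).triRel (A.twist α.inv hα.1)) n ((map_triRel hβ hα n).le h1)
  exact Eq.mpr (congrArg (· ∈ ((B.twist β.inv hβ.1).tri (A.twist α.inv hα.1)).I.deg n)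
    (prim_pw_toD₁ β α n _)) h2

/-- Minimality only has to be checked on generators, where the twisted relations are the images of
`J^⊥ ⊗ I`. -/
theorem tri_deg_le (hβ : B.SecondAdmissible β.inv.toFun)
    (hα : A.SecondAdmissible α.inv.toFun) (J : GIdeal k (B.D₁ A))
    (hJ : IsTwistedRel (A := A) (B := B) (Z2.j β.dual α) J) (n : ℕ) :
    ((B.twist β.inv hβ.1).tri (A.twist α.inv hα.1)).I.deg n ≤ J.deg n := by
  let J' : GIdeal k (Module.Dual k B.V ⊗[k] A.V) := J
  have h1 : ∀ n, (B.triRel A n).map (triCochain β α n).toLinearMap ≤ J'.deg n := fun n =>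
    Submodule.map_le_iff_le_comap.2 (triRel_le fun F hF x hx =>
      Eq.mp (congrArg (· ∈ J'.deg n) (prim_pw_toD₁ β α n _)) (hJ n F hF x hx))
  exact GIdeal.gen_le (J := J') (fun n => (map_triRel hβ hα n).symm.le.trans (h1 n)) n

theorem exists_isInitial (hβ : B.SecondAdmissible β.inv.toFun)
    (hα : A.SecondAdmissible α.inv.toFun) (ω : Z2 k (B.D₁ A ⊗[k] B.V))
    (hω : ω = Z2.j₃ β.dual α (Z2.one k B.V)) :
    ∃ X : Omega A B ω, Nonempty (Limits.IsInitial X) ∧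
      X.space = (B.twist β.inv hβ.1).tri (A.twist α.inv hα.1) := by
  subst hω
  let T := (B.twist β.inv hβ.1).tri (A.twist α.inv hα.1)
  exact ⟨univOmega (h0 := T.I_zero) (h1 := T.I_one) (isTwistedRel_tri hβ hα)
    (admissible_tri_twist hβ hα), univOmega_isInitial _ _ (tri_deg_le hβ hα), rfl⟩

end

/-- The quantum spaces of two initial objects are isomorphic. -/
def spaceIso {A B : CA k} {ω : Z2 k (B.D₁ A ⊗[k] B.V)} {X Y : Omega A B ω}
    (hX : Limits.IsInitial X) (hY : Limits.IsInitial Y) : X.space ≅ Y.space :=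
  ((IsOmega ω).ι ⋙ StructuredArrow.proj _ _).mapIso (hX.uniqueUpToIso hY)

/-! ### Functoriality of `▷` and the unit -/

theorem dualPw_pw_dualMap {V W : Type u} [AddCommGroup V] [Module k V] [FiniteDimensional k V]
    [AddCommGroup W] [Module k W] [FiniteDimensional k W] (g : V →ₗ[k] W) {n : ℕ}
    (F : ⨂[k]^n (Module.Dual k W)) (x : ⨂[k]^n V) :
    dualPw n (pw g.dualMap n F) x = dualPw n F (pw g n x) := by
  have : (dualPw (k := k) (V := V) n).toLinearMap ∘ₗ pw g.dualMap n =
      (pw g n).dualMap ∘ₗ (dualPw n).toLinearMap := by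
    apply tensor_ext
    intro f
    apply tensor_ext
    intro a
    simp only [LinearMap.comp_apply, LinearEquiv.coe_coe, LinearMap.dualMap_apply, pw_tprod,
      dualPw_tprod]
  exact LinearMap.congr_fun (LinearMap.congr_fun this F) x

/-- The transpose of a map carrying `J'` into `J` carries `J^⊥` into `J'^⊥`; this gives the
contravariance of `▷` in its first argument. -/
theorem pw_dualMap_mem_triRel {A A' B B' : CA k} (g : Hom B' B) (f : Hom A A') {n : ℕ}
    {F : ⨂[k]^n (Module.Dual k B.V)} {x : ⨂[k]^n A.V} (hF : F ∈ B.perp n)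
    (hx : x ∈ A.I.deg n) : pw (V := Module.Dual k B.V ⊗[k] A.V)
      (W := Module.Dual k B'.V ⊗[k] A'.V) (TensorProduct.map g.lin.dualMap f.lin) n
      ((shuffle n).symm (F ⊗ₜ x)) ∈ B'.triRel A' n := by
  have e := shuffle_pw g.lin.dualMap f.lin n ((shuffle n).symm (F ⊗ₜ x))
  rw [LinearEquiv.apply_symm_apply, TensorProduct.map_tmul, ← LinearEquiv.eq_symm_apply] at e
  refine Eq.mpr (congrArg (· ∈ B'.triRel A' n) e) ?_
  refine shuffle_symm_mem_triRel ?_ (f.map_rel n hx)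
  refine (Submodule.mem_dualAnnihilator _).2 fun y hy => ?_
  exact (dualPw_pw_dualMap g.lin F y).trans
    ((Submodule.mem_dualAnnihilator _).1 hF _ (g.map_rel n hy))

theorem _root_.QSpace.GIdeal.gen_le_comap_gen {V W : Type u} [AddCommGroup V] [Module k V]
    [AddCommGroup W] [Module k W] (f : V →ₗ[k] W) {R : ∀ n : ℕ, Submodule k (⨂[k]^n V)}
    {R' : ∀ n : ℕ, Submodule k (⨂[k]^n W)} (h : ∀ n, ∀ x ∈ R n, pw f n x ∈ R' n) (n : ℕ) :
    (GIdeal.gen R).deg n ≤ ((GIdeal.gen R').comap f).deg n :=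
  GIdeal.gen_le (J := GIdeal.comap (GIdeal.gen R') f)
    (fun n x hx => GIdeal.le_gen R' n (h n x hx)) n

theorem triRel_le_comap {A A' B B' : CA k} (g : Hom B' B) (f : Hom A A') (n : ℕ) :
    B.triRel A n ≤ (B'.triRel A' n).comap (pw (V := Module.Dual k B.V ⊗[k] A.V)
      (W := Module.Dual k B'.V ⊗[k] A'.V) (TensorProduct.map g.lin.dualMap f.lin) n) :=
  triRel_le fun _ hF _ hx => pw_dualMap_mem_triRel g f hF hx

theorem pw_dualMap_mem_gen {A A' B B' : CA k} (g : Hom B' B) (f : Hom A A') (n : ℕ) :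
    (B.tri A).I.deg n ≤ ((B'.tri A').I.comap (V := (B.tri A).V) (W := (B'.tri A').V)
      (TensorProduct.map g.lin.dualMap f.lin)).deg n := by
  have h : ∀ n, ∀ x ∈ B.triRel A n, pw (V := (B.tri A).V) (W := (B'.tri A').V)
      (TensorProduct.map g.lin.dualMap f.lin) n x ∈ B'.triRel A' n :=
    fun n _ hx => triRel_le_comap g f n hx
  exact GIdeal.gen_le_comap_gen (V := (B.tri A).V) (W := (B'.tri A').V) (R := B.triRel A)
    (R' := B'.triRel A') (TensorProduct.map g.lin.dualMap f.lin) h n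

/-- `▷` is contravariant in its first and covariant in its second argument. -/
def triMap {A A' B B' : CA k} (g : Hom B' B) (f : Hom A A') : Hom (B.tri A) (B'.tri A') where
  lin := TensorProduct.map g.lin.dualMap f.lin
  map_rel := pw_dualMap_mem_gen g f

theorem map_dualMap_comp {V V' W W' : Type u} [AddCommGroup V] [Module k V] [AddCommGroup V']
    [Module k V'] [AddCommGroup W] [Module k W] [AddCommGroup W'] [Module k W']
    {g : V' →ₗ[k] V} {g' : V →ₗ[k] V'} {f : W →ₗ[k] W'} {f' : W' →ₗ[k] W}
    (hg : g ∘ₗ g' = LinearMap.id) (hf : f' ∘ₗ f = LinearMap.id) :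
    TensorProduct.map g'.dualMap f' ∘ₗ TensorProduct.map g.dualMap f = LinearMap.id := by
  have hd : g'.dualMap ∘ₗ g.dualMap = LinearMap.id := by
    refine LinearMap.ext fun φ => LinearMap.ext fun v => ?_
    exact congrArg φ (LinearMap.congr_fun hg v)
  rw [← TensorProduct.map_comp, hd, hf]
  exact TensorProduct.map_id

/-- `▷` of isomorphic spaces. -/
def triIso {A A' B B' : CA k} (i : B ≅ B') (j : A ≅ A') : B.tri A ≅ B'.tri A' where
  hom := triMap i.inv j.hom
  inv := triMap i.hom j.inv
  hom_inv_id := Hom.ext (map_dualMap_comp (congrArg Hom.lin i.hom_inv_id)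
    (congrArg Hom.lin j.hom_inv_id))
  inv_hom_id := Hom.ext (map_dualMap_comp (congrArg Hom.lin i.inv_hom_id)
    (congrArg Hom.lin j.inv_hom_id))

theorem twist_unitObj (α : Z2 k (unitObj k).V) (h : (unitObj k).Admissible α.inv.toFun) :
    (unitObj k).twist α.inv h = unitObj k := by
  refine eq_of_deg_eq fun n => ?_
  refine (twist_inv_deg (unitObj k) α h n).trans ?_
  exact Submodule.map_bot _

theorem pw_mk {V W : Type u} [AddCommGroup V] [Module k V] [AddCommGroup W] [Module k W] (w : W)
    {n : ℕ} (x : ⨂[k]^n V) : pw (TensorProduct.mk k W V w) n x =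
      (shuffle n).symm (PiTensorProduct.tprod k (fun _ => w) ⊗ₜ x) := by
  have : pw (TensorProduct.mk k W V w) n = (shuffle n).symm.toLinearMap ∘ₗ
      TensorProduct.mk k (⨂[k]^n W) (⨂[k]^n V) (PiTensorProduct.tprod k (fun _ => w)) := by
    apply tensor_ext
    intro a
    rw [pw_tprod, LinearMap.comp_apply, TensorProduct.mk_apply, ← shuffle_tprod]
    exact ((shuffle n).symm_apply_apply _).symm
  exact LinearMap.congr_fun this x

/-- Applying a functional to every `W`-factor leaves a scalar multiple of `x`. For evaluation at `1`
this shows that relations of `𝒦 ▷ 𝒜` become relations of `𝒜`. -/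
theorem pw_lift_shuffle_symm {V W : Type u} [AddCommGroup V] [Module k V] [AddCommGroup W]
    [Module k W] (g : Module.Dual k W) {n : ℕ} (w : Fin n → W) (x : ⨂[k]^n V) :
    pw ((TensorProduct.lid k V).toLinearMap ∘ₗ TensorProduct.map g LinearMap.id) n
      ((shuffle n).symm (PiTensorProduct.tprod k w ⊗ₜ x)) = (∏ i, g (w i)) • x := by
  have : pw ((TensorProduct.lid k V).toLinearMap ∘ₗ TensorProduct.map g LinearMap.id) n ∘ₗ
      (shuffle n).symm.toLinearMap ∘ₗ TensorProduct.mk k (⨂[k]^n W) (⨂[k]^n V)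
        (PiTensorProduct.tprod k w) = (∏ i, g (w i)) • LinearMap.id := by
    apply tensor_ext
    intro a
    rw [LinearMap.comp_apply, LinearMap.comp_apply, TensorProduct.mk_apply, ← shuffle_tprod,
      LinearEquiv.coe_coe, LinearEquiv.symm_apply_apply, pw_tprod]
    simp only [LinearMap.comp_apply, TensorProduct.map_tmul, LinearEquiv.coe_coe,
      TensorProduct.lid_tmul, LinearMap.id_apply, LinearMap.smul_apply]
    rw [MultilinearMap.map_smul_univ]
  exact LinearMap.congr_fun this x

/-- Evaluation at `1`, `k^* → k`. -/
def evalOne (k : Type u) [Field k] : Module.Dual k (Module.Dual k k) :=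
  Module.Dual.eval k k 1

theorem pw_evalOne_mem (A : CA k) {n : ℕ} (F : ⨂[k]^n (Module.Dual k k)) {x : ⨂[k]^n A.V}
    (hx : x ∈ A.I.deg n) :
    pw ((TensorProduct.lid k A.V).toLinearMap ∘ₗ TensorProduct.map (evalOne k) LinearMap.id) n
      ((shuffle n).symm (F ⊗ₜ x)) ∈ A.I.deg n := by
  induction F using PiTensorProduct.induction_on with
  | smul_tprod c f =>
    rw [← TensorProduct.smul_tmul', map_smul, map_smul, pw_lift_shuffle_symm]
    exact Submodule.smul_mem _ _ (Submodule.smul_mem _ _ hx)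
  | add F G hF hG =>
    rw [TensorProduct.add_tmul, map_add, map_add]
    exact Submodule.add_mem _ hF hG

theorem mem_perp_unitObj {n : ℕ} (F : ⨂[k]^n (Module.Dual k (unitObj k).V)) :
    F ∈ (unitObj k).perp n := by
  refine (Submodule.mem_dualAnnihilator _).2 fun y hy => ?_
  obtain rfl : y = 0 := hy
  exact map_zero _

/-- `𝒦 ▷ 𝒜 → 𝒜`. -/
def unitTriHom (A : CA k) : Hom ((unitObj k).tri A) A where
  lin := (TensorProduct.lid k A.V).toLinearMap ∘ₗ TensorProduct.map (evalOne k) LinearMap.id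
  map_rel n := GIdeal.gen_le (J := A.I.comap _)
    (fun _ => triRel_le fun F _ _ hx => pw_evalOne_mem A F hx) n

/-- `𝒜 → 𝒦 ▷ 𝒜`. -/
def unitTriInv (A : CA k) : Hom A ((unitObj k).tri A) where
  lin := TensorProduct.mk k (Module.Dual k k) A.V LinearMap.id
  map_rel n x hx := by
    have h := GIdeal.le_gen (V := Module.Dual k (unitObj k).V ⊗[k] A.V)
      ((unitObj k).triRel A) n (shuffle_symm_mem_triRel (B := unitObj k)
      (mem_perp_unitObj (PiTensorProduct.tprod k fun _ => (LinearMap.id : k →ₗ[k] k))) hx)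
    exact Eq.mpr (congrArg (· ∈ ((unitObj k).tri A).I.deg n)
      (pw_mk (W := Module.Dual k k) LinearMap.id x)) h

/-- `𝒦 ▷ 𝒜 ≅ 𝒜`. -/
def unitTri (A : CA k) : (unitObj k).tri A ≅ A where
  hom := unitTriHom A
  inv := unitTriInv A
  hom_inv_id := by
    apply Hom.ext
    apply TensorProduct.ext'
    intro f a
    let f' : Module.Dual k k := f
    -- A functional on `k` is `f(1)` times the identity, so the scalar moves across the tensor sign.
    change (LinearMap.id : Module.Dual k k) ⊗ₜ[k] (f' (1 : k) • a) = f' ⊗ₜ a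
    rw [← TensorProduct.smul_tmul]
    congr 1
    ext
    simp
  inv_hom_id := by
    apply Hom.ext
    refine LinearMap.ext fun a => ?_
    change (1 : k) • a = a
    exact one_smul _ _

theorem nonempty_space_iso {A B : CA k} {β : Z2 k B.V} {α : Z2 k A.V}
    (hβ : B.SecondAdmissible β.inv.toFun) (hα : A.SecondAdmissible α.inv.toFun)
    {ω : Z2 k (B.D₁ A ⊗[k] B.V)} (hω : ω = Z2.j₃ β.dual α (Z2.one k B.V)) {X : Omega A B ω}
    (hX : Limits.IsInitial X) :
    Nonempty (X.space ≅ (B.twist β.inv hβ.1).tri (A.twist α.inv hα.1)) := by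
  obtain ⟨Y, ⟨hY⟩, e⟩ := exists_isInitial hβ hα ω hω
  exact ⟨spaceIso hX hY ≪≫ eqToIso e⟩

theorem nonempty_space_iso_of_unitObj {A : CA k} {κ : Z2 k (unitObj k).V} {α : Z2 k A.V}
    (hκ : (unitObj k).SecondAdmissible κ.inv.toFun) (hα : A.SecondAdmissible α.inv.toFun)
    {ω : Z2 k ((unitObj k).D₁ A ⊗[k] (unitObj k).V)}
    (hω : ω = Z2.j₃ κ.dual α (Z2.one k (unitObj k).V)) {X : Omega A (unitObj k) ω}
    (hX : Limits.IsInitial X) : Nonempty (X.space ≅ A.twist α.inv hα.1) := by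
  obtain ⟨i⟩ := nonempty_space_iso hκ hα hω hX
  exact ⟨i ≪≫ eqToIso (congrArg (fun C => CA.tri C _) (twist_unitObj κ hκ.1)) ≪≫ unitTri _⟩

end CA

end QSpace

end

/-! ### The main theorem. -/

open QSpace QSpace.CA in
theorem mainTheorem3 {k : Type u} [Field k]
    (ω : ∀ A B : CA k, Z2 k (B.D₁ A ⊗[k] B.V))
    (ψ : ∀ A : CA k, Z2 k A.V)
    (hω : FactorizedBy ω ψ)
    (hψ : ∀ A : CA k, A.SecondAdmissible (ψ A).inv.toFun) :
    (∀ A B : CA k,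
      (∃ X : Omega A B (ω A B), Nonempty (Limits.IsInitial X) ∧
        X.space = (B.twist (ψ B).inv (hψ B).1).tri (A.twist (ψ A).inv (hψ A).1)) ∧
      ∃ h : (B.tri A).Admissible (Z2.j (ψ B).inv.dual (ψ A).inv).toFun,
        (B.twist (ψ B).inv (hψ B).1).tri (A.twist (ψ A).inv (hψ A).1) =
          (B.tri A).twist (Z2.j (ψ B).inv.dual (ψ A).inv) h) ∧
    (∀ (A : CA k) (X : Omega A (unitObj k) (ω A (unitObj k))), Limits.IsInitial X →
      Nonempty (X.space ≅ A.twist (ψ A).inv (hψ A).1)) ∧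
    (∀ X : Omega (unitObj k) (unitObj k) (ω (unitObj k) (unitObj k)), Limits.IsInitial X →
      Nonempty (X.space ≅ unitObj k)) ∧
    (∀ (A B : CA k) (X : Omega A B (ω A B)) (Y : Omega B (unitObj k) (ω B (unitObj k)))
      (Z : Omega A (unitObj k) (ω A (unitObj k))),
      Limits.IsInitial X → Limits.IsInitial Y → Limits.IsInitial Z →
      Nonempty (X.space ≅ Y.space.tri Z.space)) := by
  refine ⟨fun A B => ⟨exists_isInitial (hψ B) (hψ A) _ (hω A B),
    admissible_tri_inv (hψ B) (hψ A), tri_twist_eq (hψ B) (hψ A)⟩, ?_, ?_, ?_⟩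
  · intro A X hX
    exact nonempty_space_iso_of_unitObj (hψ _) (hψ A) (hω _ _) hX
  · intro X hX
    obtain ⟨i⟩ := nonempty_space_iso_of_unitObj (hψ _) (hψ _) (hω _ _) hX
    exact ⟨i ≪≫ eqToIso (twist_unitObj _ (hψ _).1)⟩
  · intro A B X Y Z hX hY hZ
    obtain ⟨i⟩ := nonempty_space_iso (hψ B) (hψ A) (hω _ _) hX
    obtain ⟨j⟩ := nonempty_space_iso_of_unitObj (hψ _) (hψ B) (hω _ _) hY
    obtain ⟨l⟩ := nonempty_space_iso_of_unitObj (hψ _) (hψ A) (hω _ _) hZ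
    exact ⟨i ≪≫ triIso j.symm l.symm⟩
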